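/- All algebras are unital over $\mathbb{C}$ and all Hopf algebras have bijective antipode. Let $A$ and $H$ be Hopf algebras and $\pi:A\to H$ a surjective Hopf algebra map. Let $\Gamma_H$ be the group of grouplike elements of $H$, and assume that $H$ is cosemisimple and that every element of $\Gamma_H$ is central in $H$. Let $K_H := H/\langle \gamma-1 \mid \gamma\in\Gamma_H\rangle$, a quotient Hopf algebra of $H$, with canonical projection $\mathrm{proj}_K:H\to K_H$, and set $$B := A^{\mathrm{co}(H)}=\{a\in A: a_{(1)}\otimes\pi(a_{(2)})=a\otimes 1\},\qquad P := A^{\mathrm{co}(K_H)}=\{a\in A: a_{(1)}\otimes\mathrm{proj}_K\pi(a_{(2)})=a\otimes 1\}$$ (a group algebra principal pair). For $\gamma\in\Gamma_H$ let $\mathcal{E}_\gamma:=\{p\in P: p_{(1)}\otimes\pi(p_{(2)})=p\otimes\gamma\}$. Let ${}^A_B\mathrm{Mod}_0$ be the category of relative Hopf modules: left $B$-modules $\mathcal{F}$ with a left $A$-coaction $\Delta_L$ such that $\Delta_L(bf)=\Delta(b)\Delta_L(f)$, each endowed with the right $B$-action $fb:=f_{(-2)}\,b\,S(f_{(-1)})f_{(0)}$,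 with morphisms the left $A$-colinear left $B$-linear maps. It is monoidal for $\otimes_B$ (left $B$-action on the first factor, diagonal $A$-coaction) with unit $B$. A relative line module over $B$ is an invertible object of ${}^A_B\mathrm{Mod}_0$. For an object $\mathcal{F}$, let $\Phi(\mathcal{F}):=\mathcal{F}/B^+\mathcal{F}$, with $B^+:=B\cap\ker\varepsilon$, with the left $H$-coaction $[f]\mapsto\pi(f_{(-1)})\otimes[f_{(0)}]$. Then: 1. $P=\bigoplus_{\gamma\in\Gamma_H}\mathcal{E}_\gamma$, and this is a strong $\Gamma_H$-grading: $\mathcal{E}_\gamma\mathcal{E}_{\gamma'}=\mathcal{E}_{\gamma\gamma'}$ for all $\gamma,\gamma'\in\Gamma_H$. 2. $B=\mathcal{E}_{1}$ is the component of the identity element of $\Gamma_H$. Moreover $\ker\pi=B^+A$, so that $\pi$ identifies $\pi_B:A\to A/B^+A$ with $\pi:A\to H$. Each $\mathcal{E}_\gamma$ is a relative line module over $B$, we have $\pi(\mathcal{E}_\gamma)=\mathbb{C}\gamma$, and $[e]\mapsto\pi(e)$ is a well-defined isomorphism of left $H$-comodules $\Phi(\mathcal{E}_\gamma)\cong\mathbb{C}\gamma$.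 3. Every relative line module over $B$ is isomorphic, in ${}^A_B\mathrm{Mod}_0$, to $\mathcal{E}_\gamma$ for some $\gamma\in\Gamma_H$. 4. Each $\mathcal{E}_\gamma$ is a simple sub-object of $P$ in ${}^A_B\mathrm{Mod}_0$, and $P=\bigoplus_\gamma\mathcal{E}_\gamma$ is the unique decomposition of $P$ as an internal direct sum of simple sub-objects: any set of simple sub-objects of $P$ whose internal direct sum is $P$ equals $\{\mathcal{E}_\gamma:\gamma\in\Gamma_H\}$. -/

import Mathlib

universe u v w w'

open scoped TensorProduct

noncomputable section

namespace GroupAlgebraPair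

open TensorProduct WithConv

/-! ### Comodules and cosemisimplicity -/

/-- A left coaction of a coalgebra `C` on a complex vector space `M`. -/
structure LeftCoaction (C : Type u) (M : Type v) [AddCommGroup C] [Module ℂ C] [Coalgebra ℂ C]
    [AddCommGroup M] [Module ℂ M] where
  coact : M →ₗ[ℂ] C ⊗[ℂ] M
  coassoc : ∀ m, TensorProduct.assoc ℂ C C M (Coalgebra.comul.rTensor M (coact m)) =
    coact.lTensor C (coact m)
  counit_coact : ∀ m, TensorProduct.lid ℂ M (Coalgebra.counit.rTensor M (coact m)) = m

section Coalg

variable {C : Type u} [AddCommGroup C] [Module ℂ C] [Coalgebra ℂ C]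

/-- `D` is a subcoalgebra: `Δ(D) ⊆ D ⊗ D`. -/
def IsSubcoalgebra (D : Submodule ℂ C) : Prop :=
  ∀ x ∈ D, Coalgebra.comul (R := ℂ) x ∈ LinearMap.range (TensorProduct.map D.subtype D.subtype)

/-- `D` is a simple subcoalgebra: non-zero, with no proper non-zero subcoalgebra. -/
def IsSimpleSubcoalgebra (D : Submodule ℂ C) : Prop :=
  IsSubcoalgebra D ∧ D ≠ ⊥ ∧ ∀ D' ≤ D, IsSubcoalgebra D' → D' = ⊥ ∨ D' = D

variable (C) in
/-- A coalgebra is cosemisimple if it is the sum of its simple subcoalgebras. -/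
def IsCosemisimple : Prop :=
  sSup {D : Submodule ℂ C | IsSimpleSubcoalgebra D} = ⊤

end Coalg

/-! ### The quotient Hopf algebra `K_H` -/

section KH

variable (H : Type v) [Ring H] [HopfAlgebra ℂ H]

/-- The two-sided ideal of `H` generated by `g - 1`, for `g` grouplike. -/
def groupLikeIdeal : Ideal H :=
  (TwoSidedIdeal.span {x : H | ∃ g : GroupLike ℂ H, x = g.val - 1}).asIdeal

instance : (groupLikeIdeal H).IsTwoSided := by unfold groupLikeIdeal; infer_instance

variable {H} in
theorem sub_one_mem (g : GroupLike ℂ H) : g.val - 1 ∈ groupLikeIdeal H := by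
  rw [groupLikeIdeal, TwoSidedIdeal.mem_asIdeal]
  exact TwoSidedIdeal.subset_span ⟨g, rfl⟩

variable {H} in
theorem groupLikeIdeal_induction {p : H → Prop} (hg : ∀ g : GroupLike ℂ H, p (g.val - 1))
    (h0 : p 0) (hadd : ∀ x y, p x → p y → p (x + y)) (hneg : ∀ x, p x → p (-x))
    (hl : ∀ a x, p x → p (a * x)) (hr : ∀ x a, p x → p (x * a))
    {x : H} (hx : x ∈ groupLikeIdeal H) : p x := by
  rw [groupLikeIdeal, TwoSidedIdeal.mem_asIdeal] at hx
  let I : TwoSidedIdeal H := TwoSidedIdeal.mk' {x | p x} h0 (fun {x y} hx hy => hadd x y hx hy)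
    (fun {x} hx => hneg x hx) (fun {a x} hx => hl a x hx) (fun {x a} hx => hr x a hx)
  have h : TwoSidedIdeal.span {x : H | ∃ g : GroupLike ℂ H, x = g.val - 1} ≤ I := by
    rw [TwoSidedIdeal.span_le]
    rintro _ ⟨g, rfl⟩
    simpa [I] using hg g
  have := h hx
  simpa [I] using this

instance : (groupLikeIdeal H).IsHopfIdeal ℂ where
  counit_eq_zero := by
    intro x hx
    refine groupLikeIdeal_induction (p := fun x => Coalgebra.counit (R := ℂ) x = 0)
      ?_ ?_ ?_ ?_ ?_ ?_ hx <;> intros <;> simp_all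
  map_mkQ_comul_eq_zero := by
    intro x hx
    let q : H →ₐ[ℂ] H ⧸ groupLikeIdeal H := Ideal.Quotient.mkₐ ℂ (groupLikeIdeal H)
    let f : H →ₐ[ℂ] (H ⧸ groupLikeIdeal H) ⊗[ℂ] (H ⧸ groupLikeIdeal H) :=
      (Algebra.TensorProduct.map q q).comp (Bialgebra.comulAlgHom ℂ H)
    have key : f x = 0 := by
      refine groupLikeIdeal_induction (p := fun x => f x = 0) ?_ ?_ ?_ ?_ ?_ ?_ hx
      · intro g
        have hq : q g.val = 1 := by
          have h : q (g.val - 1) = 0 := Ideal.Quotient.eq_zero_iff_mem.2 (sub_one_mem g)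
          rwa [map_sub, map_one, sub_eq_zero] at h
        have hc : f g.val = q g.val ⊗ₜ q g.val := by
          simp [f, g.isGroupLikeElem_val.comul_eq_tmul_self]
        rw [map_sub, map_one, hc, hq, Algebra.TensorProduct.one_def, sub_self]
      all_goals intros; simp_all
    exact key
  antipode_mem := by
    intro x hx
    refine groupLikeIdeal_induction
      (p := fun x => HopfAlgebra.antipode ℂ x ∈ groupLikeIdeal H) ?_ ?_ ?_ ?_ ?_ ?_ hx
    · intro g
      have := sub_one_mem g⁻¹
      simpa [HopfAlgebra.antipode_one] using this
    · simp
    · intro x y hx hy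
      rw [map_add]; exact Ideal.add_mem _ hx hy
    · intro x hx
      rw [map_neg]; exact neg_mem hx
    · intro a x hx
      rw [HopfAlgebra.antipode_mul_antidistrib]; exact Ideal.mul_mem_right _ _ hx
    · intro a x hx
      rw [HopfAlgebra.antipode_mul_antidistrib]; exact Ideal.mul_mem_left _ _ hx

/-- The quotient Hopf algebra `K_H = H / ⟨g - 1 | g grouplike⟩`. -/
abbrev KH : Type v := H ⧸ groupLikeIdeal H

/-- The canonical projection `H → K_H`. -/
def projK : H →ₐc[ℂ] KH H := Bialgebra.Quotient.mkBialgHom (groupLikeIdeal H)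

variable {H} in
theorem projK_groupLike (g : GroupLike ℂ H) : projK H g.val = 1 := by
  have h : projK H (g.val - 1) = 0 := Ideal.Quotient.eq_zero_iff_mem.2 (sub_one_mem g)
  rwa [map_sub, map_one, sub_eq_zero] at h

end KH

/-! ### Coinvariants and homogeneous components -/

section Coinv

variable {A : Type u} [Ring A] [HopfAlgebra ℂ A] {K : Type w} [Ring K] [HopfAlgebra ℂ K]

/-- The right coaction `(id ⊗ p) ∘ Δ` of `K` on `A` associated to a Hopf algebra map `p : A → K`. -/
def rightCoaction (p : A →ₐc[ℂ] K) : A →ₐ[ℂ] A ⊗[ℂ] K :=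
  (Algebra.TensorProduct.map (AlgHom.id ℂ A) (p : A →ₐ[ℂ] K)).comp (Bialgebra.comulAlgHom ℂ A)

/-- The algebra of coinvariants `A^{co(K)} = {a | (id ⊗ p) Δ(a) = a ⊗ 1}`. -/
def coinvariants (p : A →ₐc[ℂ] K) : Subalgebra ℂ A :=
  AlgHom.equalizer (rightCoaction p) Algebra.TensorProduct.includeLeft

theorem mem_coinvariants {p : A →ₐc[ℂ] K} {a : A} :
    a ∈ coinvariants p ↔ rightCoaction p a = a ⊗ₜ 1 := Iff.rfl

/-- The subspace `{a | (id ⊗ p) Δ(a) = a ⊗ g}`. -/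
def weightSpace (p : A →ₐc[ℂ] K) (g : K) : Submodule ℂ A :=
  LinearMap.eqLocus (rightCoaction p).toLinearMap ((TensorProduct.mk ℂ A K).flip g)

theorem mem_weightSpace {p : A →ₐc[ℂ] K} {g : K} {a : A} :
    a ∈ weightSpace p g ↔ rightCoaction p a = a ⊗ₜ g := Iff.rfl

theorem rightCoaction_comul (p : A →ₐc[ℂ] K) (a : A) :
    (rightCoaction p).toLinearMap.lTensor A (Coalgebra.comul a) =
      TensorProduct.assoc ℂ A A K (Coalgebra.comul.rTensor K (rightCoaction p a)) := by
  have h1 : ∀ x : A ⊗[ℂ] A, (rightCoaction p).toLinearMap.lTensor A x =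
      ((p : A →ₐ[ℂ] K).toLinearMap.lTensor A).lTensor A (Coalgebra.comul.lTensor A x) := by
    intro x
    induction x with
    | zero => simp
    | add x y hx hy => simp only [map_add, hx, hy]
    | tmul x y => rfl
  have h2 : ∀ x : A ⊗[ℂ] A, Coalgebra.comul.rTensor K
        (Algebra.TensorProduct.map (AlgHom.id ℂ A) (p : A →ₐ[ℂ] K) x) =
      (p : A →ₐ[ℂ] K).toLinearMap.lTensor (A ⊗[ℂ] A) (Coalgebra.comul.rTensor A x) := by
    intro x
    induction x with
    | zero => simp
    | add x y hx hy => simp only [map_add, hx, hy]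
    | tmul x y => rfl
  have h3 : ∀ x : (A ⊗[ℂ] A) ⊗[ℂ] A, ((p : A →ₐ[ℂ] K).toLinearMap.lTensor A).lTensor A
        (TensorProduct.assoc ℂ A A A x) =
      TensorProduct.assoc ℂ A A K ((p : A →ₐ[ℂ] K).toLinearMap.lTensor (A ⊗[ℂ] A) x) := by
    intro x
    induction x with
    | zero => simp
    | add x y hx hy => simp only [map_add, hx, hy]
    | tmul x y =>
      induction x with
      | zero => simp
      | add x y hx hy => simp only [add_tmul, map_add, hx, hy]
      | tmul x z => rfl
  rw [h1, ← Coalgebra.coassoc_apply, h3]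
  congr 1
  exact (h2 _).symm

theorem comul_mem_of_mem_weightSpace (p : A →ₐc[ℂ] K) (g : K) {a : A} (ha : a ∈ weightSpace p g) :
    Coalgebra.comul (R := ℂ) a ∈ LinearMap.range ((weightSpace p g).subtype.lTensor A) := by
  let f : A →ₗ[ℂ] A ⊗[ℂ] K := (rightCoaction p).toLinearMap - (TensorProduct.mk ℂ A K).flip g
  have hex : Function.Exact (weightSpace p g).subtype f := by
    intro x
    have h : f x = 0 ↔ x ∈ weightSpace p g := by
      rw [mem_weightSpace]; exact sub_eq_zero
    rw [h]
    exact ⟨fun hx => ⟨⟨x, hx⟩, rfl⟩, fun ⟨y, hy⟩ => hy ▸ y.2⟩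
  have hT := Module.Flat.lTensor_exact A hex
  refine (hT _).1 ?_
  have e1 : ∀ x : A ⊗[ℂ] A, ((TensorProduct.mk ℂ A K).flip g).lTensor A x =
      TensorProduct.assoc ℂ A A K (x ⊗ₜ g) := by
    intro x
    induction x with
    | zero => simp
    | add x y hx hy => simp only [add_tmul, map_add, hx, hy]
    | tmul x y => rfl
  rw [LinearMap.lTensor_sub, LinearMap.sub_apply, rightCoaction_comul, mem_weightSpace.1 ha, e1]
  simp

end Coinv

/-! ### The adjoint action -/

section Adjoint

variable {A : Type u} [Ring A] [HopfAlgebra ℂ A]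

/-- The adjoint action `adj a b = a₍₁₎ b S(a₍₂₎)`. -/
def adj : A →ₗ[ℂ] A →ₗ[ℂ] A :=
  (TensorProduct.lift (LinearMap.mk₂ ℂ
    (fun x y => LinearMap.mulLeft ℂ x ∘ₗ LinearMap.mulRight ℂ (HopfAlgebra.antipode ℂ y))
    (by intros; ext; simp [add_mul]) (by intros; ext; simp)
    (by intros; ext; simp [mul_add]) (by intros; ext; simp))) ∘ₗ Coalgebra.comul

theorem adj_repr {a : A} {ι : Type*} (r : Coalgebra.Repr ℂ a ι) (b : A) :
    adj a b = ∑ i ∈ r.index, r.left i * (b * HopfAlgebra.antipode ℂ (r.right i)) := by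
  simp [adj, ← r.eq, LinearMap.sum_apply]

theorem adj_conv (c : A) : toConv (adj.flip c) =
    toConv (LinearMap.mulRight ℂ c) * toConv (HopfAlgebra.antipode ℂ (A := A)) := by
  ext a
  rw [(Coalgebra.Repr.arbitrary ℂ a).convMul_apply]
  simp [adj_repr (Coalgebra.Repr.arbitrary ℂ a), mul_assoc]

theorem adj_mul (a a' b : A) : adj (a * a') b = adj a (adj a' b) := by
  let r := Coalgebra.Repr.arbitrary ℂ a
  let r' := Coalgebra.Repr.arbitrary ℂ a'
  have h : Coalgebra.comul (R := ℂ) (a * a') = ∑ i ∈ r.index, ∑ j ∈ r'.index,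
      (r.left i * r'.left j) ⊗ₜ[ℂ] (r.right i * r'.right j) := by
    rw [Bialgebra.comul_mul, ← r.eq, ← r'.eq]
    simp [Finset.sum_mul_sum]
  rw [adj_repr r, adj_repr r']
  simp [adj, h, LinearMap.sum_apply, HopfAlgebra.antipode_mul_antidistrib, Finset.mul_sum,
    Finset.sum_mul, mul_assoc]

/-- `a₍₁₎ c S(a₍₂₎) a₍₃₎ = a c`. -/
theorem adj_conv_id (c : A) :
    toConv (adj.flip c) * toConv LinearMap.id = toConv (LinearMap.mulRight ℂ c) := by
  rw [adj_conv, mul_assoc, LinearMap.antipode_mul_id, mul_one]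

variable {C : Type*} [Ring C] [Algebra ℂ C]

theorem conv_inv_right (h : A →ₐ[ℂ] C) :
    toConv h.toLinearMap * toConv (h.toLinearMap ∘ₗ HopfAlgebra.antipode ℂ) = 1 := by
  have := LinearMap.algHom_comp_convMul_distrib h (toConv LinearMap.id)
    (toConv (HopfAlgebra.antipode ℂ (A := A)))
  rw [LinearMap.id_mul_antipode] at this
  apply WithConv.ext
  refine this.symm.trans ?_
  ext a
  simp

theorem conv_inv_left (h : A →ₐ[ℂ] C) :
    toConv (h.toLinearMap ∘ₗ HopfAlgebra.antipode ℂ) * toConv h.toLinearMap = 1 := by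
  have := LinearMap.algHom_comp_convMul_distrib h (toConv (HopfAlgebra.antipode ℂ (A := A)))
    (toConv LinearMap.id)
  rw [LinearMap.antipode_mul_id] at this
  apply WithConv.ext
  refine this.symm.trans ?_
  ext a
  simp

theorem conv_cancel (h : A →ₐ[ℂ] C) {f g : WithConv (A →ₗ[ℂ] C)}
    (e : f * toConv h.toLinearMap = g * toConv h.toLinearMap) : f = g := by
  have := congrArg (· * toConv (h.toLinearMap ∘ₗ HopfAlgebra.antipode ℂ)) e
  simpa [mul_assoc, conv_inv_right] using this

theorem algHom_adj_conv (h : A →ₐ[ℂ] C) (c : A) :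
    toConv (h.toLinearMap ∘ₗ adj.flip c) * toConv h.toLinearMap =
      toConv (h.toLinearMap ∘ₗ LinearMap.mulRight ℂ c) := by
  have := LinearMap.algHom_comp_convMul_distrib h (toConv (adj.flip c)) (toConv LinearMap.id)
  rw [adj_conv_id] at this
  exact WithConv.ext this.symm

variable {H : Type v} [Ring H] [HopfAlgebra ℂ H]

theorem rightCoaction_conv (p : A →ₐc[ℂ] H) : toConv (rightCoaction p).toLinearMap =
    toConv (Algebra.TensorProduct.includeLeft : A →ₐ[ℂ] A ⊗[ℂ] H).toLinearMap *
      toConv ((Algebra.TensorProduct.includeRight : H →ₐ[ℂ] A ⊗[ℂ] H).toLinearMap ∘ₗ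
        (p : A →ₐ[ℂ] H).toLinearMap) := by
  ext a
  rw [(Coalgebra.Repr.arbitrary ℂ a).convMul_apply]
  have : rightCoaction p a = Algebra.TensorProduct.map (AlgHom.id ℂ A) (p : A →ₐ[ℂ] H)
    (Coalgebra.comul a) := rfl
  simp [this, ← (Coalgebra.Repr.arbitrary ℂ a).eq]

theorem adj_mem (p : A →ₐc[ℂ] H) (a : A) {b : A} (hb : b ∈ coinvariants p) :
    adj a b ∈ coinvariants p := by
  rw [mem_coinvariants] at hb ⊢
  have key : toConv ((rightCoaction p).toLinearMap ∘ₗ adj.flip b) =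
      toConv ((Algebra.TensorProduct.includeLeft : A →ₐ[ℂ] A ⊗[ℂ] H).toLinearMap ∘ₗ
        adj.flip b) := by
    apply conv_cancel (rightCoaction p)
    rw [algHom_adj_conv]
    conv_rhs => rw [rightCoaction_conv, ← mul_assoc, algHom_adj_conv]
    ext a
    have hc : rightCoaction p a = Algebra.TensorProduct.map (AlgHom.id ℂ A) (p : A →ₐ[ℂ] H)
      (Coalgebra.comul a) := rfl
    rw [(Coalgebra.Repr.arbitrary ℂ a).convMul_apply]
    simp [hb, hc, ← (Coalgebra.Repr.arbitrary ℂ a).eq, Finset.sum_mul]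
  exact congrArg (fun f => f.ofConv a) key

end Adjoint

/-! ### Restricting the comultiplication to left coideals -/

section Restrict

variable {A : Type u} [Ring A] [HopfAlgebra ℂ A] {N : Type w} [AddCommGroup N] [Module ℂ N]

/-- The coaction on `N` obtained by restricting `Δ` along an injection `i : N → A`
whose image `i(N)` satisfies `Δ(i(N)) ⊆ A ⊗ i(N)`. -/
def restrictComul (i : N →ₗ[ℂ] A) (hi : Function.Injective i)
    (h : ∀ n, Coalgebra.comul (R := ℂ) (i n) ∈ LinearMap.range (i.lTensor A)) :
    N →ₗ[ℂ] A ⊗[ℂ] N :=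
  (LinearEquiv.ofInjective (i.lTensor A)
    (Module.Flat.lTensor_preserves_injective_linearMap i hi)).symm.toLinearMap ∘ₗ
    (Coalgebra.comul ∘ₗ i).codRestrict _ h

theorem lTensor_restrictComul (i : N →ₗ[ℂ] A) (hi : Function.Injective i)
    (h : ∀ n, Coalgebra.comul (R := ℂ) (i n) ∈ LinearMap.range (i.lTensor A)) (n : N) :
    i.lTensor A (restrictComul i hi h n) = Coalgebra.comul (i n) := by
  have := LinearEquiv.apply_symm_apply (LinearEquiv.ofInjective (i.lTensor A)
    (Module.Flat.lTensor_preserves_injective_linearMap i hi))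
    ((Coalgebra.comul ∘ₗ i).codRestrict _ h n)
  exact congrArg Subtype.val this

/-- `restrictComul` as a left coaction. -/
def restrictCoaction (i : N →ₗ[ℂ] A) (hi : Function.Injective i)
    (h : ∀ n, Coalgebra.comul (R := ℂ) (i n) ∈ LinearMap.range (i.lTensor A)) :
    LeftCoaction A N where
  coact := restrictComul i hi h
  coassoc n := by
    apply Module.Flat.lTensor_preserves_injective_linearMap (M := A) _
      (Module.Flat.lTensor_preserves_injective_linearMap (M := A) i hi)
    have h1 : ∀ x : A ⊗[ℂ] N, (i.lTensor A).lTensor A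
        (TensorProduct.assoc ℂ A A N (Coalgebra.comul.rTensor N x)) =
        TensorProduct.assoc ℂ A A A (Coalgebra.comul.rTensor A (i.lTensor A x)) := by
      intro x
      induction x with
      | zero => simp
      | add x y hx hy => simp only [map_add, hx, hy]
      | tmul x n =>
        simp only [LinearMap.rTensor_tmul, LinearMap.lTensor_tmul]
        generalize Coalgebra.comul (R := ℂ) x = z
        induction z with
        | zero => simp
        | add x y hx hy => simp only [add_tmul, map_add, hx, hy]
        | tmul x y => rfl
    have h2 : ∀ x : A ⊗[ℂ] N, (i.lTensor A).lTensor A ((restrictComul i hi h).lTensor A x) =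
        Coalgebra.comul.lTensor A (i.lTensor A x) := by
      intro x
      induction x with
      | zero => simp
      | add x y hx hy => simp only [map_add, hx, hy]
      | tmul x n => simp [lTensor_restrictComul]
    rw [h1, h2, lTensor_restrictComul, Coalgebra.coassoc_apply]
  counit_coact n := by
    apply hi
    have h1 : ∀ x : A ⊗[ℂ] N, i (TensorProduct.lid ℂ N (Coalgebra.counit.rTensor N x)) =
        TensorProduct.lid ℂ A (Coalgebra.counit.rTensor A (i.lTensor A x)) := by
      intro x
      induction x with
      | zero => simp
      | add x y hx hy => simp only [map_add, hx, hy]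
      | tmul x n => simp
    rw [h1, lTensor_restrictComul, Coalgebra.rTensor_counit_comul]
    simp

end Restrict

/-! ### Relative Hopf modules over `B = A^{co(H)}` -/

section RelHopf

variable {A : Type u} [Ring A] [HopfAlgebra ℂ A] {H : Type v} [Ring H] [HopfAlgebra ℂ H]
variable (π : A →ₐc[ℂ] H)

/-- The base algebra `B = A^{co(H)}`. -/
abbrev Base : Subalgebra ℂ A := coinvariants π

theorem comul_base_mem (b : Base π) : Coalgebra.comul (R := ℂ) ((Base π).val.toLinearMap b) ∈
    LinearMap.range ((Base π).val.toLinearMap.lTensor A) := by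
  let j : weightSpace π (1 : H) →ₗ[ℂ] Base π :=
    LinearMap.codRestrict (Subalgebra.toSubmodule (Base π)) (weightSpace π (1 : H)).subtype
      (fun x => x.2)
  obtain ⟨x, hx⟩ := comul_mem_of_mem_weightSpace π (1 : H) (a := b.1) b.2
  refine ⟨j.lTensor A x, ?_⟩
  rw [← LinearMap.comp_apply, ← LinearMap.lTensor_comp]
  exact hx

/-- The left coaction `B → A ⊗ B` given by restricting `Δ`. -/
def baseCoaction : LeftCoaction A (Base π) :=
  restrictCoaction (Base π).val.toLinearMap Subtype.val_injective (comul_base_mem π)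

theorem lTensor_baseCoaction (b : Base π) :
    (Base π).val.toLinearMap.lTensor A ((baseCoaction π).coact b) = Coalgebra.comul b.1 :=
  lTensor_restrictComul (Base π).val.toLinearMap Subtype.val_injective (comul_base_mem π) b

/-- The adjoint action of `A` on `B`, `a ⊗ b ↦ a₍₁₎ b S(a₍₂₎)`. -/
def adjBase : A →ₗ[ℂ] Base π →ₗ[ℂ] Base π :=
  LinearMap.mk₂ ℂ (fun a b => ⟨adj a b.1, adj_mem π a b.2⟩)
    (by intros; ext; simp) (by intros; ext; simp) (by intros; ext; simp) (by intros; ext; simp)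

@[simp]
theorem coe_adjBase (a : A) (b : Base π) : (adjBase π a b : A) = adj a b.1 := rfl

/-- The action of `B` on a left `B`-module, as a linear map. -/
def actBase (F : Type w) [AddCommGroup F] [Module ℂ F] [Module (Base π) F]
    [IsScalarTower ℂ (Base π) F] : Base π →ₗ[ℂ] F →ₗ[ℂ] F :=
  (Algebra.lsmul ℂ ℂ F).toLinearMap

@[simp]
theorem actBase_apply (F : Type w) [AddCommGroup F] [Module ℂ F] [Module (Base π) F]
    [IsScalarTower ℂ (Base π) F] (b : Base π) (f : F) : actBase π F b f = b • f := rfl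

/-- The objects of the category of relative Hopf modules: left `B`-modules with a left
`A`-coaction such that `Δ_L(b f) = Δ(b) Δ_L(f)`, where `A ⊗ B` acts on `A ⊗ F` factorwise. -/
structure RelHopfMod where
  carrier : Type w
  [addCommGroup : AddCommGroup carrier]
  [moduleComplex : Module ℂ carrier]
  [moduleBase : Module (Base π) carrier]
  [isScalarTower : IsScalarTower ℂ (Base π) carrier]
  coaction : LeftCoaction A carrier
  coact_smul : ∀ (b : Base π) (f : carrier), coaction.coact (b • f) =
    TensorProduct.map₂ (LinearMap.mul ℂ A) (actBase π carrier)
      ((baseCoaction π).coact b) (coaction.coact f)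

attribute [instance] RelHopfMod.addCommGroup RelHopfMod.moduleComplex RelHopfMod.moduleBase
  RelHopfMod.isScalarTower

variable {π}

/-- Isomorphism of relative Hopf modules: a bijective left `B`-linear left `A`-colinear map. -/
def RelHopfMod.IsIso (F : RelHopfMod.{u, v, w} π) (G : RelHopfMod.{u, v, w'} π) : Prop :=
  ∃ e : F.carrier ≃ₗ[ℂ] G.carrier, (∀ (b : Base π) (f : F.carrier), e (b • f) = b • e f) ∧
    ∀ f : F.carrier, G.coaction.coact (e f) = e.toLinearMap.lTensor A (F.coaction.coact f)

/-! ### Sub-objects of `A` -/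

variable (π) in
/-- `S ⊆ A` is a sub-object of `A` in the category of relative Hopf modules: a left
`B`-submodule and a left `A`-subcomodule. -/
def IsSubobject (S : Submodule ℂ A) : Prop :=
  (∀ b ∈ Base π, ∀ s ∈ S, b * s ∈ S) ∧
    ∀ s ∈ S, Coalgebra.comul (R := ℂ) s ∈ LinearMap.range (S.subtype.lTensor A)

/-- A sub-object of `A`, as a relative Hopf module. -/
def ofSubobject (S : Submodule ℂ A) (hS : IsSubobject π S) : RelHopfMod.{u, v, u} π :=
  letI : Module (Base π) S :=
    { smul := fun b s => ⟨b.1 * s.1, hS.1 b.1 b.2 s.1 s.2⟩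
      one_smul := fun s => Subtype.ext (one_mul s.1)
      mul_smul := fun a b s => Subtype.ext (mul_assoc a.1 b.1 s.1)
      smul_zero := fun a => Subtype.ext (mul_zero a.1)
      smul_add := fun a s t => Subtype.ext (mul_add a.1 s.1 t.1)
      add_smul := fun a b s => Subtype.ext (add_mul a.1 b.1 s.1)
      zero_smul := fun s => Subtype.ext (zero_mul s.1) }
  haveI : IsScalarTower ℂ (Base π) S := ⟨fun c b s => Subtype.ext (smul_mul_assoc c b.1 s.1)⟩
  { carrier := S
    coaction := restrictCoaction S.subtype Subtype.val_injective (fun s => hS.2 s.1 s.2)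
    coact_smul := by
      intro b s
      have hcoe : ∀ (b : Base π) (s : S), ((b • s : S) : A) = b.1 * s.1 := fun _ _ => rfl
      apply Module.Flat.lTensor_preserves_injective_linearMap (M := A) S.subtype
        Subtype.val_injective
      have h1 : ∀ (y : A ⊗[ℂ] Base π) (x : A ⊗[ℂ] S), S.subtype.lTensor A
          (TensorProduct.map₂ (LinearMap.mul ℂ A) (actBase π S) y x) =
          (Base π).val.toLinearMap.lTensor A y * S.subtype.lTensor A x := by
        intro y x
        induction y with
        | zero => simp
        | add y y' h h' => simp only [map_add, LinearMap.add_apply, add_mul, h, h']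
        | tmul a b =>
          induction x with
          | zero => simp
          | add x x' h h' => simp only [map_add, mul_add, h, h']
          | tmul a' s => simp [hcoe]
      rw [h1, lTensor_baseCoaction]
      have h2 : ∀ s : S, S.subtype.lTensor A (restrictComul S.subtype Subtype.val_injective
          (fun s => hS.2 s.1 s.2) s) = Coalgebra.comul s.1 :=
        lTensor_restrictComul S.subtype Subtype.val_injective _
      refine (h2 (b • s)).trans ?_
      refine Eq.trans ?_ (congrArg (Coalgebra.comul b.1 * ·) (h2 s)).symm
      exact Bialgebra.comul_mul b.1 s.1 }

theorem isSubobject_base : IsSubobject π (Subalgebra.toSubmodule (Base π)) :=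
  ⟨fun _ hb _ hs => (Base π).mul_mem hb hs, fun s hs => comul_base_mem π ⟨s, hs⟩⟩

variable (π) in
/-- `B` as a relative Hopf module: the unit object for `⊗_B`. -/
def unitObject : RelHopfMod.{u, v, u} π := ofSubobject _ (isSubobject_base (π := π))

theorem isSubobject_weightSpace (g : H) : IsSubobject π (weightSpace π g) := by
  refine ⟨fun b hb s hs => ?_, fun s hs => comul_mem_of_mem_weightSpace π g hs⟩
  rw [mem_weightSpace] at hs ⊢
  rw [map_mul, hs, mem_coinvariants.1 hb]
  simp

/-! ### The right `B`-action and the tensor product `⊗_B` -/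

variable (π) in
/-- The linear map `a ⊗ f ↦ (a₍₁₎ b S(a₍₂₎)) f`. -/
def adjAct (F : Type w) [AddCommGroup F] [Module ℂ F] [Module (Base π) F]
    [IsScalarTower ℂ (Base π) F] : Base π →ₗ[ℂ] A ⊗[ℂ] F →ₗ[ℂ] F :=
  LinearMap.mk₂ ℂ (fun b x => TensorProduct.lift (actBase π F ∘ₗ (adjBase π).flip b) x)
    (by
      intro b b' x
      induction x with
      | zero => simp
      | add x y hx hy => rw [map_add, hx, hy]; simp only [map_add]; abel
      | tmul a f => simp)
    (by
      intro c b x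
      induction x with
      | zero => simp
      | add x y hx hy => rw [map_add, hx, hy]; simp only [map_add, smul_add]
      | tmul a f => simp)
    (by intros; simp) (by intros; simp)

@[simp]
theorem adjAct_tmul (F : Type w) [AddCommGroup F] [Module ℂ F] [Module (Base π) F]
    [IsScalarTower ℂ (Base π) F] (b : Base π) (a : A) (f : F) :
    adjAct π F b (a ⊗ₜ f) = adjBase π a b • f := rfl

/-- The right action `f b := f₍₋₂₎ b S(f₍₋₁₎) f₍₀₎` of `B` on a relative Hopf module. -/
def RelHopfMod.rightAct (F : RelHopfMod.{u, v, w} π) : Base π →ₗ[ℂ] F.carrier →ₗ[ℂ] F.carrier :=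
  (LinearMap.lcomp ℂ F.carrier F.coaction.coact) ∘ₗ adjAct π F.carrier

theorem RelHopfMod.rightAct_apply (F : RelHopfMod.{u, v, w} π) (b : Base π) (f : F.carrier) :
    F.rightAct b f = adjAct π F.carrier b (F.coaction.coact f) := rfl

theorem lift_adj_comul (z c : A) :
    LinearMap.mul' ℂ A ((adj.flip c).rTensor A (Coalgebra.comul z)) = z * c :=
  congrArg (fun f => f.ofConv z) (adj_conv_id c)

/-- `b' (f b) = (b' f) b`. -/
theorem RelHopfMod.rightAct_smul (F : RelHopfMod.{u, v, w} π) (b b' : Base π) (f : F.carrier) :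
    F.rightAct b (b' • f) = b' • F.rightAct b f := by
  rw [rightAct_apply, rightAct_apply, F.coact_smul]
  generalize F.coaction.coact f = x
  induction x with
  | zero => simp
  | add x y hx hy => simp only [map_add, smul_add, hx, hy]
  | tmul a f =>
    have h1 : ∀ y : A ⊗[ℂ] Base π, adjAct π F.carrier b
        (TensorProduct.map₂ (LinearMap.mul ℂ A) (actBase π F.carrier) y (a ⊗ₜ f)) =
        (LinearMap.mul' ℂ (Base π) (((adjBase π).flip b ∘ₗ LinearMap.mulRight ℂ a).rTensor
          (Base π) y)) • f := by
      intro y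
      induction y with
      | zero => simp
      | add x y hx hy => simp only [map_add, LinearMap.add_apply, add_smul, hx, hy]
      | tmul x b => simp [mul_smul]
    have h2 : ∀ y : A ⊗[ℂ] Base π, (LinearMap.mul' ℂ (Base π)
        (((adjBase π).flip b ∘ₗ LinearMap.mulRight ℂ a).rTensor (Base π) y)).1 =
        LinearMap.mul' ℂ A ((adj.flip (adj a b.1)).rTensor A
          ((Base π).val.toLinearMap.lTensor A y)) := by
      intro y
      induction y with
      | zero => simp
      | add x y hx hy => simp only [map_add, Subalgebra.coe_add, hx, hy]
      | tmul x b => simp [adj_mul]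
    have h3 : LinearMap.mul' ℂ (Base π) (((adjBase π).flip b ∘ₗ LinearMap.mulRight ℂ a).rTensor
        (Base π) ((baseCoaction π).coact b')) = b' * adjBase π a b := by
      apply Subtype.ext
      rw [h2, lTensor_baseCoaction, lift_adj_comul]
      rfl
    rw [h1, h3, adjAct_tmul, mul_smul]

theorem comul_conv : toConv (Bialgebra.comulAlgHom ℂ A).toLinearMap =
    toConv (Algebra.TensorProduct.includeLeft : A →ₐ[ℂ] A ⊗[ℂ] A).toLinearMap *
      toConv (Algebra.TensorProduct.includeRight : A →ₐ[ℂ] A ⊗[ℂ] A).toLinearMap := by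
  ext a
  rw [(Coalgebra.Repr.arbitrary ℂ a).convMul_apply]
  simp [(Coalgebra.Repr.arbitrary ℂ a).eq]

/-- `Δ(adj(a₍₁₎) c) (a₍₂₎ ⊗ 1) = a₍₁₎ c₍₁₎ ⊗ adj(a₍₂₎) c₍₂₎`. -/
theorem comul_adj (c : A) :
    toConv ((Bialgebra.comulAlgHom ℂ A).toLinearMap ∘ₗ adj.flip c) *
      toConv (Algebra.TensorProduct.includeLeft : A →ₐ[ℂ] A ⊗[ℂ] A).toLinearMap =
    toConv ((TensorProduct.map₂ (LinearMap.mul ℂ A) adj).flip (Coalgebra.comul c) ∘ₗ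
      Coalgebra.comul) := by
  apply conv_cancel (Algebra.TensorProduct.includeRight : A →ₐ[ℂ] A ⊗[ℂ] A)
  rw [mul_assoc, ← comul_conv, algHom_adj_conv]
  have h : ∀ y : A ⊗[ℂ] A,
      toConv ((TensorProduct.map₂ (LinearMap.mul ℂ A) adj).flip y ∘ₗ Coalgebra.comul) *
        toConv (Algebra.TensorProduct.includeRight : A →ₐ[ℂ] A ⊗[ℂ] A).toLinearMap =
      toConv (LinearMap.mulRight ℂ y ∘ₗ Coalgebra.comul) := by
    intro y
    induction y with
    | zero => ext; simp
    | add x y hx hy =>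
      have e1 : toConv ((TensorProduct.map₂ (LinearMap.mul ℂ A) adj).flip (x + y) ∘ₗ
          Coalgebra.comul) =
          toConv ((TensorProduct.map₂ (LinearMap.mul ℂ A) adj).flip x ∘ₗ Coalgebra.comul) +
          toConv ((TensorProduct.map₂ (LinearMap.mul ℂ A) adj).flip y ∘ₗ Coalgebra.comul) := by
        ext; simp
      rw [e1, add_mul, hx, hy]
      ext; simp [mul_add]
    | tmul x y =>
      have e1 : toConv ((TensorProduct.map₂ (LinearMap.mul ℂ A) adj).flip (x ⊗ₜ[ℂ] y) ∘ₗ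
          Coalgebra.comul) =
          toConv ((Algebra.TensorProduct.includeLeft : A →ₐ[ℂ] A ⊗[ℂ] A).toLinearMap ∘ₗ
            LinearMap.mulRight ℂ x) *
          toConv ((Algebra.TensorProduct.includeRight : A →ₐ[ℂ] A ⊗[ℂ] A).toLinearMap ∘ₗ
            adj.flip y) := by
        ext a
        rw [(Coalgebra.Repr.arbitrary ℂ a).convMul_apply]
        simp [← (Coalgebra.Repr.arbitrary ℂ a).eq]
      rw [e1, mul_assoc, algHom_adj_conv]
      ext a
      rw [(Coalgebra.Repr.arbitrary ℂ a).convMul_apply]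
      simp [← (Coalgebra.Repr.arbitrary ℂ a).eq]
  rw [h]
  ext a
  simp

/-- `Δ_B(adj(a₍₁₎) b) (a₍₂₎ ⊗ 1) = a₍₁₎ b₍₁₎ ⊗ adj(a₍₂₎) b₍₂₎` in `A ⊗ B`. -/
theorem comul_adjBase (b : Base π) (a : A) :
    LinearMap.mul' ℂ (A ⊗[ℂ] Base π) (TensorProduct.map
      ((baseCoaction π).coact ∘ₗ (adjBase π).flip b)
      (Algebra.TensorProduct.includeLeft : A →ₐ[ℂ] A ⊗[ℂ] Base π).toLinearMap
      (Coalgebra.comul a)) =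
    TensorProduct.map₂ (LinearMap.mul ℂ A) (adjBase π) (Coalgebra.comul a)
      ((baseCoaction π).coact b) := by
  apply Module.Flat.lTensor_preserves_injective_linearMap (M := A) (Base π).val.toLinearMap
    Subtype.val_injective
  have h := congrArg (fun f => f.ofConv a) (comul_adj b.1)
  refine Eq.trans ?_ (h.trans ?_)
  · have e : ∀ x : A ⊗[ℂ] A, (Base π).val.toLinearMap.lTensor A
        (LinearMap.mul' ℂ (A ⊗[ℂ] Base π) (TensorProduct.map
          ((baseCoaction π).coact ∘ₗ (adjBase π).flip b)
          (Algebra.TensorProduct.includeLeft : A →ₐ[ℂ] A ⊗[ℂ] Base π).toLinearMap x)) =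
        LinearMap.mul' ℂ (A ⊗[ℂ] A) (TensorProduct.map
          ((Bialgebra.comulAlgHom ℂ A).toLinearMap ∘ₗ adj.flip b.1)
          (Algebra.TensorProduct.includeLeft : A →ₐ[ℂ] A ⊗[ℂ] A).toLinearMap x) := by
      intro x
      induction x with
      | zero => simp
      | add x y hx hy => simp only [map_add, hx, hy]
      | tmul x y =>
        have hm : ∀ p q : A ⊗[ℂ] Base π, (Base π).val.toLinearMap.lTensor A (p * q) =
            (Base π).val.toLinearMap.lTensor A p * (Base π).val.toLinearMap.lTensor A q :=
          fun p q => map_mul (Algebra.TensorProduct.map (AlgHom.id ℂ A) (Base π).val) p q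
        simp only [TensorProduct.map_tmul, LinearMap.mul'_apply, hm, LinearMap.comp_apply,
          lTensor_baseCoaction]
        simp
    exact e _
  · have e : ∀ (x : A ⊗[ℂ] A) (y : A ⊗[ℂ] Base π),
        TensorProduct.map₂ (LinearMap.mul ℂ A) adj x ((Base π).val.toLinearMap.lTensor A y) =
        (Base π).val.toLinearMap.lTensor A
          (TensorProduct.map₂ (LinearMap.mul ℂ A) (adjBase π) x y) := by
      intro x y
      induction x with
      | zero => simp
      | add x x' hx hy => simp only [map_add, LinearMap.add_apply, hx, hy]
      | tmul x x' =>
        induction y with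
        | zero => simp
        | add y y' hx hy => simp only [map_add, hx, hy]
        | tmul y y' => simp
    rw [← e, lTensor_baseCoaction]
    rfl

/-- `Δ_L(f b) = f₍₋₁₎ b₍₁₎ ⊗ f₍₀₎ b₍₂₎`. -/
theorem RelHopfMod.coact_rightAct (F : RelHopfMod.{u, v, w} π) (b : Base π) (f : F.carrier) :
    F.coaction.coact (F.rightAct b f) =
      TensorProduct.map₂ (LinearMap.mul ℂ A).flip F.rightAct ((baseCoaction π).coact b)
        (F.coaction.coact f) := by
  let Θ : A ⊗[ℂ] (A ⊗[ℂ] F.carrier) →ₗ[ℂ] A ⊗[ℂ] F.carrier :=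
    TensorProduct.lift (TensorProduct.map₂ (LinearMap.mul ℂ A) (actBase π F.carrier) ∘ₗ
      (baseCoaction π).coact ∘ₗ (adjBase π).flip b)
  let Θ' : A ⊗[ℂ] (A ⊗[ℂ] F.carrier) →ₗ[ℂ] A ⊗[ℂ] F.carrier :=
    TensorProduct.map₂ (LinearMap.mul ℂ A).flip (adjAct π F.carrier) ((baseCoaction π).coact b)
  have h1 : ∀ x : A ⊗[ℂ] F.carrier, F.coaction.coact (adjAct π F.carrier b x) =
      Θ (F.coaction.coact.lTensor A x) := by
    intro x
    induction x with
    | zero => simp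
    | add x y hx hy => simp only [map_add, hx, hy]
    | tmul a f => simp [Θ, F.coact_smul]
  have h2 : ∀ x : A ⊗[ℂ] F.carrier, TensorProduct.map₂ (LinearMap.mul ℂ A).flip F.rightAct
      ((baseCoaction π).coact b) x = Θ' (F.coaction.coact.lTensor A x) := by
    intro x
    simp only [Θ']
    generalize (baseCoaction π).coact b = y
    induction y with
    | zero => simp
    | add y y' hx hy => simp only [map_add, LinearMap.add_apply, hx, hy]
    | tmul a' b' =>
      induction x with
      | zero => simp
      | add x y hx hy => simp only [map_add, hx, hy]
      | tmul a f => simp [RelHopfMod.rightAct_apply]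
  have h3 : ∀ x : A ⊗[ℂ] F.carrier,
      Θ (TensorProduct.assoc ℂ A A F.carrier (Coalgebra.comul.rTensor F.carrier x)) =
      Θ' (TensorProduct.assoc ℂ A A F.carrier (Coalgebra.comul.rTensor F.carrier x)) := by
    intro x
    induction x with
    | zero => simp
    | add x y hx hy => simp only [map_add, hx, hy]
    | tmul a f =>
      have e1 : ∀ z : A ⊗[ℂ] A, Θ (TensorProduct.assoc ℂ A A F.carrier (z ⊗ₜ f)) =
          ((actBase π F.carrier).flip f).lTensor A (LinearMap.mul' ℂ (A ⊗[ℂ] Base π)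
            (TensorProduct.map ((baseCoaction π).coact ∘ₗ (adjBase π).flip b)
            (Algebra.TensorProduct.includeLeft : A →ₐ[ℂ] A ⊗[ℂ] Base π).toLinearMap z)) := by
        intro z
        induction z with
        | zero => simp
        | add x y hx hy => simp only [map_add, add_tmul, hx, hy]
        | tmul x y =>
          simp only [Θ, TensorProduct.assoc_tmul, TensorProduct.lift.tmul, LinearMap.comp_apply,
            TensorProduct.map_tmul, LinearMap.mul'_apply, LinearMap.flip_apply]
          generalize (baseCoaction π).coact (adjBase π x b) = t
          induction t with
          | zero => simp
          | add s t hs ht => simp only [map_add, LinearMap.add_apply, add_mul, hs, ht]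
          | tmul s t => simp
      have e2 : ∀ z : A ⊗[ℂ] A, Θ' (TensorProduct.assoc ℂ A A F.carrier (z ⊗ₜ f)) =
          ((actBase π F.carrier).flip f).lTensor A (TensorProduct.map₂ (LinearMap.mul ℂ A)
            (adjBase π) z ((baseCoaction π).coact b)) := by
        intro z
        simp only [Θ']
        generalize (baseCoaction π).coact b = t
        induction t with
        | zero => simp
        | add s t hs ht => simp only [map_add, LinearMap.add_apply, hs, ht]
        | tmul s t =>
          induction z with
          | zero => simp
          | add x y hx hy => simp only [map_add, LinearMap.add_apply, add_tmul, hx, hy]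
          | tmul x y => simp
      rw [LinearMap.rTensor_tmul, e1, e2, comul_adjBase]
  rw [RelHopfMod.rightAct_apply, h1, h2, ← F.coaction.coassoc, h3]

section Tensor

variable (F : RelHopfMod.{u, v, w} π) (G : RelHopfMod.{u, v, w'} π)

/-- The subspace of `F ⊗ G` spanned by the elements `f b ⊗ g - f ⊗ b g`. -/
def balancingRelations : Submodule ℂ (F.carrier ⊗[ℂ] G.carrier) :=
  Submodule.span ℂ {x | ∃ (f : F.carrier) (b : Base π) (g : G.carrier),
    x = F.rightAct b f ⊗ₜ[ℂ] g - f ⊗ₜ[ℂ] (b • g)}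

/-- The vector space `F ⊗_B G`. -/
abbrev BalancedTensor : Type (max w w') := (F.carrier ⊗[ℂ] G.carrier) ⧸ balancingRelations F G

theorem smul_balancingRelations (b : Base π) : balancingRelations F G ≤
    (balancingRelations F G).comap ((actBase π F.carrier b).rTensor G.carrier) := by
  rw [balancingRelations, Submodule.span_le]
  rintro _ ⟨f, b', g, rfl⟩
  refine Submodule.subset_span ⟨b • f, b', g, ?_⟩
  simp [F.rightAct_smul]

/-- The left `B`-module structure of `F ⊗_B G`, on the first factor. -/
instance balancedTensorModule : Module (Base π) (BalancedTensor F G) where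
  smul b := (balancingRelations F G).mapQ (balancingRelations F G)
    ((actBase π F.carrier b).rTensor G.carrier) (smul_balancingRelations F G b)
  one_smul x := by
    obtain ⟨x, rfl⟩ := Submodule.Quotient.mk_surjective _ x
    refine congrArg Submodule.Quotient.mk ?_
    have : actBase π F.carrier 1 = LinearMap.id := by ext; simp
    rw [this]; simp
  mul_smul b b' x := by
    obtain ⟨x, rfl⟩ := Submodule.Quotient.mk_surjective _ x
    refine congrArg Submodule.Quotient.mk ?_
    have : actBase π F.carrier (b * b') = actBase π F.carrier b ∘ₗ actBase π F.carrier b' := by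
      ext; simp [mul_smul]
    rw [this, LinearMap.rTensor_comp]; rfl
  smul_zero b := map_zero _
  smul_add b x y := map_add _ _ _
  add_smul b b' x := by
    obtain ⟨x, rfl⟩ := Submodule.Quotient.mk_surjective _ x
    refine congrArg Submodule.Quotient.mk ?_
    rw [map_add, LinearMap.rTensor_add]; rfl
  zero_smul x := by
    obtain ⟨x, rfl⟩ := Submodule.Quotient.mk_surjective _ x
    refine (congrArg Submodule.Quotient.mk ?_).trans (Submodule.Quotient.mk_zero _)
    rw [map_zero, LinearMap.rTensor_zero]; rfl

theorem smul_mk_balancedTensor (b : Base π) (x : F.carrier ⊗[ℂ] G.carrier) :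
    b • (Submodule.Quotient.mk x : BalancedTensor F G) =
      Submodule.Quotient.mk ((actBase π F.carrier b).rTensor G.carrier x) := rfl

instance : IsScalarTower ℂ (Base π) (BalancedTensor F G) := ⟨fun c b x => by
  obtain ⟨x, rfl⟩ := Submodule.Quotient.mk_surjective _ x
  rw [smul_mk_balancedTensor, smul_mk_balancedTensor, ← Submodule.Quotient.mk_smul, map_smul,
    LinearMap.rTensor_smul]; rfl⟩

/-- The diagonal coaction `f ⊗ g ↦ f₍₋₁₎ g₍₋₁₎ ⊗ f₍₀₎ ⊗ g₍₀₎` on `F ⊗ G`. -/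
def diagCoact : F.carrier ⊗[ℂ] G.carrier →ₗ[ℂ] A ⊗[ℂ] (F.carrier ⊗[ℂ] G.carrier) :=
  TensorProduct.lift ((TensorProduct.map₂ (LinearMap.mul ℂ A)
    (TensorProduct.mk ℂ F.carrier G.carrier)).compl₁₂ F.coaction.coact G.coaction.coact)

theorem diagCoact_tmul (f : F.carrier) (g : G.carrier) : diagCoact F G (f ⊗ₜ g) =
    TensorProduct.map₂ (LinearMap.mul ℂ A) (TensorProduct.mk ℂ F.carrier G.carrier)
      (F.coaction.coact f) (G.coaction.coact g) := rfl

theorem diagCoact_coassoc (x : F.carrier ⊗[ℂ] G.carrier) :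
    TensorProduct.assoc ℂ A A _ (Coalgebra.comul.rTensor _ (diagCoact F G x)) =
      (diagCoact F G).lTensor A (diagCoact F G x) := by
  let M := TensorProduct.map₂ (LinearMap.mul ℂ A) (TensorProduct.mk ℂ F.carrier G.carrier)
  let M' := TensorProduct.map₂ (LinearMap.mul ℂ A) M
  have h1 : ∀ (x : A ⊗[ℂ] F.carrier) (y : A ⊗[ℂ] G.carrier),
      TensorProduct.assoc ℂ A A _ (Coalgebra.comul.rTensor _ (M x y)) =
      M' (TensorProduct.assoc ℂ A A _ (Coalgebra.comul.rTensor _ x))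
        (TensorProduct.assoc ℂ A A _ (Coalgebra.comul.rTensor _ y)) := by
    intro x y
    induction x with
    | zero => simp
    | add x x' hx hx' => simp only [map_add, LinearMap.add_apply, hx, hx']
    | tmul a f =>
      induction y with
      | zero => simp
      | add y y' hx hx' => simp only [map_add, hx, hx']
      | tmul a' g =>
        simp only [M, LinearMap.rTensor_tmul, TensorProduct.map₂_apply_tmul,
          TensorProduct.map_tmul, LinearMap.mul_apply', Bialgebra.comul_mul,
          TensorProduct.mk_apply]
        generalize Coalgebra.comul (R := ℂ) a = s
        generalize Coalgebra.comul (R := ℂ) a' = t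
        induction s with
        | zero => simp
        | add x x' hx hx' => simp only [map_add, add_mul, add_tmul, LinearMap.add_apply, hx, hx']
        | tmul p q =>
          induction t with
          | zero => simp
          | add x x' hx hx' => simp only [map_add, mul_add, add_tmul, hx, hx']
          | tmul p' q' => simp [M', M]
  have h2 : ∀ (x : A ⊗[ℂ] F.carrier) (y : A ⊗[ℂ] G.carrier),
      (diagCoact F G).lTensor A (M x y) =
      M' (F.coaction.coact.lTensor A x) (G.coaction.coact.lTensor A y) := by
    intro x y
    induction x with
    | zero => simp
    | add x x' hx hx' => simp only [map_add, LinearMap.add_apply, hx, hx']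
    | tmul a f =>
      induction y with
      | zero => simp
      | add y y' hx hx' => simp only [map_add, hx, hx']
      | tmul a' g => simp [M', M, diagCoact_tmul]
  induction x with
  | zero => simp
  | add x y hx hy => simp only [map_add, hx, hy]
  | tmul f g =>
    rw [diagCoact_tmul]
    exact (h1 _ _).trans ((by rw [F.coaction.coassoc, G.coaction.coassoc] :
      _ = M' (F.coaction.coact.lTensor A _) (G.coaction.coact.lTensor A _)).trans (h2 _ _).symm)

theorem diagCoact_counit (x : F.carrier ⊗[ℂ] G.carrier) :
    TensorProduct.lid ℂ _ (Coalgebra.counit.rTensor _ (diagCoact F G x)) = x := by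
  have h1 : ∀ (x : A ⊗[ℂ] F.carrier) (y : A ⊗[ℂ] G.carrier),
      TensorProduct.lid ℂ _ (Coalgebra.counit.rTensor _ (TensorProduct.map₂ (LinearMap.mul ℂ A)
        (TensorProduct.mk ℂ F.carrier G.carrier) x y)) =
      TensorProduct.lid ℂ _ (Coalgebra.counit.rTensor _ x) ⊗ₜ
        TensorProduct.lid ℂ _ (Coalgebra.counit.rTensor _ y) := by
    intro x y
    induction x with
    | zero => simp
    | add x x' hx hx' => simp only [map_add, LinearMap.add_apply, add_tmul, hx, hx']
    | tmul a f =>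
      induction y with
      | zero => simp
      | add y y' hx hx' => simp only [map_add, tmul_add, hx, hx']
      | tmul a' g => simp [TensorProduct.smul_tmul', TensorProduct.tmul_smul, smul_smul, mul_comm]
  induction x with
  | zero => simp
  | add x y hx hy => simp only [map_add, hx, hy]
  | tmul f g => rw [diagCoact_tmul, h1, F.coaction.counit_coact, G.coaction.counit_coact]

theorem mkQ_diagCoact_rel (f : F.carrier) (b : Base π) (g : G.carrier) :
    (balancingRelations F G).mkQ.lTensor A (diagCoact F G (F.rightAct b f ⊗ₜ g)) =
      (balancingRelations F G).mkQ.lTensor A (diagCoact F G (f ⊗ₜ (b • g))) := by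
  rw [diagCoact_tmul, diagCoact_tmul, F.coact_rightAct, G.coact_smul]
  generalize (baseCoaction π).coact b = t
  generalize F.coaction.coact f = x
  generalize G.coaction.coact g = y
  induction t with
  | zero => simp
  | add s t hs ht => simp only [map_add, LinearMap.add_apply, hs, ht]
  | tmul a b =>
    induction x with
    | zero => simp
    | add x x' hx hx' => simp only [map_add, LinearMap.add_apply, hx, hx']
    | tmul p f =>
      induction y with
      | zero => simp
      | add y y' hx hx' => simp only [map_add, hx, hx']
      | tmul q g =>
        have : (Submodule.Quotient.mk (F.rightAct b f ⊗ₜ[ℂ] g) : BalancedTensor F G) =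
            Submodule.Quotient.mk (f ⊗ₜ[ℂ] (b • g)) :=
          (Submodule.Quotient.eq _).2 (Submodule.subset_span ⟨f, b, g, rfl⟩)
        simp [this, mul_assoc]

/-- The diagonal coaction on `F ⊗_B G`. -/
def balancedCoact : BalancedTensor F G →ₗ[ℂ] A ⊗[ℂ] BalancedTensor F G :=
  (balancingRelations F G).liftQ ((balancingRelations F G).mkQ.lTensor A ∘ₗ diagCoact F G) (by
    refine Submodule.span_le.2 ?_
    rintro _ ⟨f, b, g, rfl⟩
    have := mkQ_diagCoact_rel F G f b g
    simp only [SetLike.mem_coe, LinearMap.mem_ker, map_sub, LinearMap.comp_apply]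
    exact sub_eq_zero.2 this)

theorem balancedCoact_mk (x : F.carrier ⊗[ℂ] G.carrier) :
    balancedCoact F G (Submodule.Quotient.mk x) =
      (balancingRelations F G).mkQ.lTensor A (diagCoact F G x) := rfl

theorem balancedCoact_smul (b : Base π) (x : BalancedTensor F G) :
    balancedCoact F G (b • x) = TensorProduct.map₂ (LinearMap.mul ℂ A)
      (actBase π (BalancedTensor F G)) ((baseCoaction π).coact b) (balancedCoact F G x) := by
  obtain ⟨x, rfl⟩ := Submodule.Quotient.mk_surjective _ x
  rw [smul_mk_balancedTensor, balancedCoact_mk, balancedCoact_mk]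
  have key : ∀ (t : A ⊗[ℂ] Base π) (x : A ⊗[ℂ] F.carrier) (y : A ⊗[ℂ] G.carrier),
      (balancingRelations F G).mkQ.lTensor A (TensorProduct.map₂ (LinearMap.mul ℂ A)
        (TensorProduct.mk ℂ F.carrier G.carrier)
        (TensorProduct.map₂ (LinearMap.mul ℂ A) (actBase π F.carrier) t x) y) =
      TensorProduct.map₂ (LinearMap.mul ℂ A) (actBase π (BalancedTensor F G)) t
        ((balancingRelations F G).mkQ.lTensor A (TensorProduct.map₂ (LinearMap.mul ℂ A)
          (TensorProduct.mk ℂ F.carrier G.carrier) x y)) := by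
    intro t x y
    induction t with
    | zero => simp only [map_zero, LinearMap.zero_apply]
    | add s t hs ht => simp only [map_add, LinearMap.add_apply, hs, ht]
    | tmul a b =>
      induction x with
      | zero => simp only [map_zero, LinearMap.zero_apply]
      | add x x' hx hx' => simp only [map_add, LinearMap.add_apply, hx, hx']
      | tmul p f =>
        induction y with
        | zero => simp only [map_zero]
        | add y y' hx hx' => simp only [map_add, hx, hx']
        | tmul q g =>
          simp only [TensorProduct.map₂_apply_tmul, TensorProduct.map_tmul,
            LinearMap.lTensor_tmul, LinearMap.mul_apply', mul_assoc]
          rfl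
  induction x with
  | zero => simp only [map_zero]
  | add x x' hx hx' => simp only [map_add, hx, hx']
  | tmul f g =>
    rw [LinearMap.rTensor_tmul, actBase_apply, diagCoact_tmul, diagCoact_tmul, F.coact_smul]
    exact key _ _ _

/-- The tensor product `F ⊗_B G` of relative Hopf modules, where `F` carries the right
`B`-action `rightAct`. -/
def tensorObject : RelHopfMod.{u, v, max w w'} π where
  carrier := BalancedTensor F G
  coaction :=
    { coact := balancedCoact F G
      coassoc := by
        intro x
        obtain ⟨x, rfl⟩ := Submodule.Quotient.mk_surjective _ x
        have h1 : ∀ z : A ⊗[ℂ] (F.carrier ⊗[ℂ] G.carrier),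
            TensorProduct.assoc ℂ A A _ (Coalgebra.comul.rTensor _
              ((balancingRelations F G).mkQ.lTensor A z)) =
            ((balancingRelations F G).mkQ.lTensor A).lTensor A
              (TensorProduct.assoc ℂ A A _ (Coalgebra.comul.rTensor _ z)) := by
          intro z
          induction z with
          | zero => simp
          | add x x' hx hx' => simp only [map_add, hx, hx']
          | tmul a x =>
            simp only [LinearMap.rTensor_tmul, LinearMap.lTensor_tmul]
            generalize Coalgebra.comul (R := ℂ) a = s
            induction s with
            | zero => simp
            | add x x' hx hx' => simp only [map_add, add_tmul, hx, hx']
            | tmul p q => simp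
        have h2 : ∀ z : A ⊗[ℂ] (F.carrier ⊗[ℂ] G.carrier),
            (balancedCoact F G).lTensor A ((balancingRelations F G).mkQ.lTensor A z) =
            ((balancingRelations F G).mkQ.lTensor A).lTensor A
              ((diagCoact F G).lTensor A z) := by
          intro z
          induction z with
          | zero => simp
          | add x x' hx hx' => simp only [map_add, hx, hx']
          | tmul a x => simp [balancedCoact_mk]
        rw [balancedCoact_mk, h1, h2, diagCoact_coassoc]
      counit_coact := by
        intro x
        obtain ⟨x, rfl⟩ := Submodule.Quotient.mk_surjective _ x
        have h1 : ∀ z : A ⊗[ℂ] (F.carrier ⊗[ℂ] G.carrier),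
            TensorProduct.lid ℂ _ (Coalgebra.counit.rTensor _
              ((balancingRelations F G).mkQ.lTensor A z)) =
            (balancingRelations F G).mkQ
              (TensorProduct.lid ℂ _ (Coalgebra.counit.rTensor _ z)) := by
          intro z
          induction z with
          | zero => simp
          | add x x' hx hx' => simp only [map_add, hx, hx']
          | tmul a x => simp
        rw [balancedCoact_mk, h1, diagCoact_counit]
        rfl }
  coact_smul := balancedCoact_smul F G

end Tensor

/-- A relative line module over `B`: an object that is invertible for `⊗_B`. -/
def IsRelativeLineModule (F : RelHopfMod.{u, v, w} π) : Prop :=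
  ∃ G : RelHopfMod.{u, v, w} π,
    (tensorObject F G).IsIso (unitObject π) ∧ (tensorObject G F).IsIso (unitObject π)

/-! ### The functor `Φ` -/

section Phi

variable (F : RelHopfMod.{u, v, w} π)

/-- The subspace `B⁺ F`, with `B⁺ = B ∩ ker ε`. -/
def augmentationSubmodule : Submodule ℂ F.carrier :=
  Submodule.span ℂ {x | ∃ (b : Base π) (f : F.carrier),
    Coalgebra.counit (R := ℂ) b.1 = 0 ∧ x = b • f}

/-- The vector space `Φ(F) = F / B⁺ F`. -/
abbrev Phi : Type w := F.carrier ⧸ augmentationSubmodule F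

theorem map_base (b : Base π) : π b.1 = algebraMap ℂ H (Coalgebra.counit b.1) := by
  have h := congrArg (fun x => TensorProduct.lid ℂ H (Coalgebra.counit.rTensor H x))
    (mem_coinvariants.1 b.2)
  have hc : rightCoaction π b.1 = Algebra.TensorProduct.map (AlgHom.id ℂ A) (π : A →ₐ[ℂ] H)
    (Coalgebra.comul b.1) := rfl
  have e : ∀ x : A ⊗[ℂ] A, TensorProduct.lid ℂ H (Coalgebra.counit.rTensor H
      (Algebra.TensorProduct.map (AlgHom.id ℂ A) (π : A →ₐ[ℂ] H) x)) =
      π (TensorProduct.lid ℂ A (Coalgebra.counit.rTensor A x)) := by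
    intro x
    induction x with
    | zero => simp
    | add x x' hx hx' => simp only [map_add, hx, hx']
    | tmul p q => simp
  rw [hc] at h
  simp only [e, Coalgebra.rTensor_counit_comul] at h
  simpa [Algebra.algebraMap_eq_smul_one] using h

variable {F} in
theorem mk_base_smul (b : Base π) (f : F.carrier) :
    (Submodule.Quotient.mk (b • f) : Phi F) =
      Coalgebra.counit (R := ℂ) b.1 • (Submodule.Quotient.mk f : Phi F) := by
  rw [← Submodule.Quotient.mk_smul, Submodule.Quotient.eq]
  refine Submodule.subset_span
    ⟨b - algebraMap ℂ (Base π) (Coalgebra.counit (R := ℂ) b.1), f, ?_, ?_⟩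
  · simp
  · simp [sub_smul]

theorem map_coact_base_smul (b : Base π) (hb : Coalgebra.counit (R := ℂ) b.1 = 0)
    (f : F.carrier) : TensorProduct.map (π : A →ₐ[ℂ] H).toLinearMap
      (augmentationSubmodule F).mkQ (F.coaction.coact (b • f)) = 0 := by
  rw [F.coact_smul]
  generalize F.coaction.coact f = x
  induction x with
  | zero => simp only [map_zero]
  | add x x' hx hx' => simp only [map_add, hx, hx', add_zero]
  | tmul p f =>
    have e : ∀ y : A ⊗[ℂ] Base π, TensorProduct.map (π : A →ₐ[ℂ] H).toLinearMap
        (augmentationSubmodule F).mkQ (TensorProduct.map₂ (LinearMap.mul ℂ A)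
          (actBase π F.carrier) y (p ⊗ₜ f)) =
        (π (TensorProduct.rid ℂ A (Coalgebra.counit.lTensor A
          ((Base π).val.toLinearMap.lTensor A y))) * π p) ⊗ₜ Submodule.Quotient.mk f := by
      intro y
      induction y with
      | zero => simp
      | add y y' hx hx' => simp only [map_add, LinearMap.add_apply, hx, hx', add_mul, add_tmul]
      | tmul a b => simp [mk_base_smul, TensorProduct.smul_tmul']
    rw [e, lTensor_baseCoaction, Coalgebra.lTensor_counit_comul]
    simp [map_base, hb]

/-- The left `H`-coaction `[f] ↦ π(f₍₋₁₎) ⊗ [f₍₀₎]` on `F / B⁺ F`, as a linear map. -/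
def phiCoact : Phi F →ₗ[ℂ] H ⊗[ℂ] Phi F :=
  (augmentationSubmodule F).liftQ
    (TensorProduct.map (π : A →ₐ[ℂ] H).toLinearMap (augmentationSubmodule F).mkQ ∘ₗ
      F.coaction.coact) (by
    refine Submodule.span_le.2 ?_
    rintro _ ⟨b, f, hb, rfl⟩
    exact map_coact_base_smul F b hb f)

theorem phiCoact_mk (f : F.carrier) : phiCoact F (Submodule.Quotient.mk f) =
    TensorProduct.map (π : A →ₐ[ℂ] H).toLinearMap (augmentationSubmodule F).mkQ
      (F.coaction.coact f) := rfl

/-- The left `H`-comodule structure of `Φ(F)`. -/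
def phiCoaction : LeftCoaction H (Phi F) where
  coact := phiCoact F
  coassoc := by
    intro x
    obtain ⟨f, rfl⟩ := Submodule.Quotient.mk_surjective _ x
    let p : A →ₗ[ℂ] H := (π : A →ₐ[ℂ] H).toLinearMap
    let q := (augmentationSubmodule F).mkQ
    have h1 : ∀ z : A ⊗[ℂ] F.carrier,
        TensorProduct.assoc ℂ H H _ (Coalgebra.comul.rTensor _ (TensorProduct.map p q z)) =
        TensorProduct.map p (TensorProduct.map p q)
          (TensorProduct.assoc ℂ A A _ (Coalgebra.comul.rTensor _ z)) := by
      intro z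
      induction z with
      | zero => simp only [map_zero]
      | add x x' hx hx' => simp only [map_add, hx, hx']
      | tmul a x =>
        have hp : Coalgebra.comul (R := ℂ) (p a) = TensorProduct.map p p (Coalgebra.comul a) :=
          (CoalgHomClass.map_comp_comul_apply π a).symm
        simp only [TensorProduct.map_tmul, LinearMap.rTensor_tmul, hp]
        generalize Coalgebra.comul (R := ℂ) a = s
        induction s with
        | zero => simp only [map_zero, zero_tmul]
        | add x x' hx hx' => simp only [map_add, add_tmul, hx, hx']
        | tmul r s => rfl
    have h2 : ∀ z : A ⊗[ℂ] F.carrier,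
        (phiCoact F).lTensor H (TensorProduct.map p q z) =
        TensorProduct.map p (TensorProduct.map p q) (F.coaction.coact.lTensor A z) := by
      intro z
      induction z with
      | zero => simp only [map_zero]
      | add x x' hx hx' => simp only [map_add, hx, hx']
      | tmul a x => rfl
    rw [phiCoact_mk]
    exact (h1 _).trans ((congrArg _ (F.coaction.coassoc f)).trans (h2 _).symm)
  counit_coact := by
    intro x
    obtain ⟨f, rfl⟩ := Submodule.Quotient.mk_surjective _ x
    have h1 : ∀ z : A ⊗[ℂ] F.carrier,
        TensorProduct.lid ℂ _ (Coalgebra.counit.rTensor _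
          (TensorProduct.map (π : A →ₐ[ℂ] H).toLinearMap (augmentationSubmodule F).mkQ z)) =
        (augmentationSubmodule F).mkQ
          (TensorProduct.lid ℂ _ (Coalgebra.counit.rTensor _ z)) := by
      intro z
      induction z with
      | zero => simp only [map_zero]
      | add x x' hx hx' => simp only [map_add, hx, hx']
      | tmul a x => simp
    rw [phiCoact_mk, h1, F.coaction.counit_coact]
    rfl

end Phi

/-! ### The total algebra and its homogeneous components -/

variable (π)

/-- The subspace `B⁺ A` of `A`, with `B⁺ = B ∩ ker ε`. -/
def augmentationIdeal : Submodule ℂ A :=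
  Submodule.span ℂ {x | ∃ b ∈ Base π, ∃ a : A, Coalgebra.counit (R := ℂ) b = 0 ∧ x = b * a}

/-- The total algebra `P = A^{co(K_H)}` of a group algebra principal pair. -/
abbrev Total : Subalgebra ℂ A := coinvariants ((projK H).comp π)

/-- The homogeneous component `E_γ = {p ∈ P | (id ⊗ π) Δ(p) = p ⊗ γ}` of degree `γ`. -/
def component (γ : GroupLike ℂ H) : Submodule ℂ A :=
  Subalgebra.toSubmodule (Total π) ⊓ weightSpace π γ.val

theorem weightSpace_le_total (γ : GroupLike ℂ H) :
    weightSpace π γ.val ≤ Subalgebra.toSubmodule (Total π) := by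
  intro a ha
  have h : rightCoaction ((projK H).comp π) a =
      (projK H : H →ₐ[ℂ] KH H).toLinearMap.lTensor A (rightCoaction π a) := by
    have e : ∀ x : A ⊗[ℂ] A, Algebra.TensorProduct.map (AlgHom.id ℂ A)
        (((projK H).comp π : A →ₐc[ℂ] KH H) : A →ₐ[ℂ] KH H) x =
        (projK H : H →ₐ[ℂ] KH H).toLinearMap.lTensor A
          (Algebra.TensorProduct.map (AlgHom.id ℂ A) (π : A →ₐ[ℂ] H) x) := by
      intro x
      induction x with
      | zero => simp only [map_zero]
      | add x x' hx hx' => simp only [map_add, hx, hx']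
      | tmul a x => rfl
    exact e _
  rw [mem_weightSpace] at ha
  have hg : (projK H : H →ₐ[ℂ] KH H).toLinearMap γ.val = 1 := projK_groupLike γ
  exact mem_coinvariants.2 (by rw [h, ha, LinearMap.lTensor_tmul, hg])

theorem isSubobject_component (γ : GroupLike ℂ H) : IsSubobject π (component π γ) := by
  rw [component, inf_eq_right.2 (weightSpace_le_total π γ)]
  exact isSubobject_weightSpace γ.val

/-- The homogeneous component `E_γ` as a relative Hopf module. -/
def componentObject (γ : GroupLike ℂ H) : RelHopfMod.{u, v, u} π :=
  ofSubobject (component π γ) (isSubobject_component π γ)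

/-- `S ⊆ A` is a simple sub-object: non-zero, with no proper non-zero sub-object. -/
def IsSimpleSubobject (S : Submodule ℂ A) : Prop :=
  IsSubobject π S ∧ S ≠ ⊥ ∧ ∀ T ≤ S, IsSubobject π T → T = ⊥ ∨ T = S

/-- The family `𝒮` of subspaces is a decomposition of `P` into simple sub-objects:
each member is a simple sub-object, and `P` is the internal direct sum of the members. -/
def IsSimpleDecomposition (𝒮 : Set (Submodule ℂ A)) : Prop :=
  (∀ S ∈ 𝒮, IsSimpleSubobject π S) ∧ sSupIndep 𝒮 ∧ sSup 𝒮 = Subalgebra.toSubmodule (Total π)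

end RelHopf

end GroupAlgebraPair

end

/-! Write `ρ = (id ⊗ π) Δ` for the right coaction of `H` on `A`. The proof runs on one tool. Since
`H` is the sum of its simple subcoalgebras, each line `ℂ g` with `g` grouplike has a complementary
subcoalgebra, and the resulting coordinate `φ_g : H → ℂ` satisfies `(id ⊗ φ_g) Δ = φ_g(·) g = (φ_g ⊗
id) Δ` (`exists_isGroupLikeFunctional`); for `g = 1` it is the Haar functional. The operator `hit π
φ_g : a ↦ a₍₁₎ φ_g(π(a₍₂₎))` then projects `A` onto the weight space of `g`, which is `E_g`.

Grading. The projections separate the `E_γ`, so these are independent. By uniqueness of `φ_g`,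
translation by a grouplike permutes the `φ_g`; hence `σ = ∑ φ_g` is translation invariant and, by
centrality, kills the ideal defining `K_H`. As `σ(1) = 1`, the operator of `σ` is the identity on
`P`, and it is also the pointwise finite sum of the projections onto the `E_γ`. So `P = ∑ E_γ`.

Everything else rests on the identity `hit_φ(a S(t₍₁₎)) t₍₂₎ = φ(g π(S(t))) a` for `a` of weight `g`
(`hit_mul_antipode_of_mem_weightSpace`). With `a = 1`, `φ = φ_γ` and `t ∈ E_{γ⁻¹}` of counit `1` it
gives `1 ∈ E_γ E_{γ⁻¹}`, hence the strong grading. With `φ = φ_1` and `t` in a sub-object `T` it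
puts a multiple of `a` into `T`; for `0 ≠ T ⊆ P` this forces some `E_δ ⊆ T`, whence simplicity and
the unique decomposition. Its form before the weight is used (`hit_mul_antipode`) gives `ker π = B⁺
A`.

Line modules. From `1 ∈ E_γ E_{γ⁻¹}`, multiplication is an isomorphism `E_γ ⊗_B E_{γ⁻¹} ≅ B`.
Conversely, the averaging map `a ⊗ m ↦ E(a S(m₍₋₁₎)) m₍₀₎`, with `E = hit π φ_1 : A → B`, recovers
`F` from `Φ(F)`; in particular `Φ(F) = 0` implies `F = 0`. If `F ⊗_B G ≅ B`, then `Φ(F) ⊗ Φ(G)` is a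
nonzero quotient of a cyclic module on which `B` acts by `ε`, so `Φ(F)` is a line. Its coaction is
given by a grouplike `γ`, and the matrix coefficient map `m ↦ m₍₋₁₎ f(m₍₀₎)` identifies `F` with
`E_γ`. -/

noncomputable section

namespace GroupAlgebraPair

open TensorProduct WithConv

/-! ### Grouplike elements and their coordinate functionals on a cosemisimple coalgebra -/

section Functional

variable {C : Type u} [AddCommGroup C] [Module ℂ C]

theorem range_map_subtype_mono {D E : Submodule ℂ C} (h : D ≤ E) :
    LinearMap.range (TensorProduct.map D.subtype D.subtype) ≤
      LinearMap.range (TensorProduct.map E.subtype E.subtype) := by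
  rintro _ ⟨x, rfl⟩
  refine ⟨TensorProduct.map (Submodule.inclusion h) (Submodule.inclusion h) x, ?_⟩
  rw [← LinearMap.comp_apply, ← TensorProduct.map_comp]
  rfl

theorem lTensor_eq_zero_of_mem_range {D : Submodule ℂ C} {φ : C →ₗ[ℂ] ℂ} (hφ : ∀ x ∈ D, φ x = 0)
    {z : C ⊗[ℂ] C} (hz : z ∈ LinearMap.range (TensorProduct.map D.subtype D.subtype)) :
    φ.lTensor C z = 0 := by
  obtain ⟨y, rfl⟩ := hz
  induction y with
  | zero => simp
  | add x y hx hy => rw [map_add, map_add, hx, hy, add_zero]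
  | tmul x y => simp [hφ y.1 y.2]

theorem rTensor_eq_zero_of_mem_range {D : Submodule ℂ C} {φ : C →ₗ[ℂ] ℂ} (hφ : ∀ x ∈ D, φ x = 0)
    {z : C ⊗[ℂ] C} (hz : z ∈ LinearMap.range (TensorProduct.map D.subtype D.subtype)) :
    φ.rTensor C z = 0 := by
  obtain ⟨y, rfl⟩ := hz
  induction y with
  | zero => simp
  | add x y hx hy => rw [map_add, map_add, hx, hy, add_zero]
  | tmul x y => simp [hφ x.1 x.2]

theorem lid_rTensor_mem_of_mem_range {D : Submodule ℂ C} (φ : C →ₗ[ℂ] ℂ)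
    {z : C ⊗[ℂ] C} (hz : z ∈ LinearMap.range (TensorProduct.map D.subtype D.subtype)) :
    TensorProduct.lid ℂ C (φ.rTensor C z) ∈ D := by
  obtain ⟨y, rfl⟩ := hz
  induction y with
  | zero => simp
  | add x y hx hy => rw [map_add, map_add, map_add]; exact D.add_mem hx hy
  | tmul x y => simpa using D.smul_mem _ y.2

variable [Coalgebra ℂ C]

theorem isSubcoalgebra_sSup {S : Set (Submodule ℂ C)} (hS : ∀ D ∈ S, IsSubcoalgebra D) :
    IsSubcoalgebra (sSup S) := by
  have : sSup S ≤ (LinearMap.range (TensorProduct.map (sSup S).subtype (sSup S).subtype)).comap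
      Coalgebra.comul :=
    sSup_le fun D hD x hx => range_map_subtype_mono (le_sSup hD) (hS D hD x hx)
  exact fun x hx => this hx

theorem isSubcoalgebra_span_singleton {g : C} (hg : IsGroupLikeElem ℂ g) :
    IsSubcoalgebra (ℂ ∙ g) := by
  intro x hx
  obtain ⟨c, rfl⟩ := Submodule.mem_span_singleton.1 hx
  refine ⟨c • ((⟨g, Submodule.mem_span_singleton_self g⟩ : (ℂ ∙ g)) ⊗ₜ
    (⟨g, Submodule.mem_span_singleton_self g⟩ : (ℂ ∙ g))), ?_⟩
  simp [hg.comul_eq_tmul_self]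

/-- A grouplike element in the sum of two subcoalgebras lies in one of them. -/
theorem groupLike_mem_or_mem_of_mem_sup {D E : Submodule ℂ C} (hD : IsSubcoalgebra D)
    (hE : IsSubcoalgebra E) {g : C} (hg : IsGroupLikeElem ℂ g) (h : g ∈ D ⊔ E) :
    g ∈ D ∨ g ∈ E := by
  by_contra! hn
  -- Apply `φ ⊗ id` to `Δ(g)`, with `φ` zero on `D` and `φ(g) ≠ 0`: the `D` part of `g` contributes
  -- nothing and the `E` part stays in `E`, so `φ(g) g ∈ E`.
  obtain ⟨φ, hφg, hφ⟩ := Submodule.exists_le_ker_of_notMem hn.1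
  obtain ⟨d, hd, e, he, hde⟩ := Submodule.mem_sup.1 h
  have h1 : TensorProduct.lid ℂ C (φ.rTensor C (Coalgebra.comul g)) = φ g • g := by
    simp [hg.comul_eq_tmul_self]
  have h2 : TensorProduct.lid ℂ C (φ.rTensor C (Coalgebra.comul g)) ∈ E := by
    rw [← hde, map_add, map_add, map_add,
      rTensor_eq_zero_of_mem_range (fun x hx => hφ hx) (hD d hd), map_zero, zero_add]
    exact lid_rTensor_mem_of_mem_range φ (hE e he)
  rw [h1] at h2
  exact hn.2 ((E.smul_mem_iff hφg).1 h2)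

theorem exists_mem_of_groupLike_mem_sSup {S : Set (Submodule ℂ C)}
    (hS : ∀ D ∈ S, IsSubcoalgebra D) {g : C} (hg : IsGroupLikeElem ℂ g) (h : g ∈ sSup S) :
    ∃ D ∈ S, g ∈ D := by
  classical
  obtain ⟨s, hs, hgs⟩ := Submodule.mem_sSup_iff_exists_finset.1 h
  clear h
  induction s using Finset.induction_on with
  | empty => exact absurd (by simpa using hgs) hg.ne_zero
  | insert D s _ ih =>
    rw [Finset.coe_insert, Set.insert_subset_iff] at hs
    rw [Finset.iSup_insert] at hgs
    have h2 : IsSubcoalgebra (⨆ i ∈ s, i) := by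
      have := isSubcoalgebra_sSup (S := (s : Set (Submodule ℂ C))) (fun D hD => hS D (hs.2 hD))
      rwa [sSup_eq_iSup] at this
    rcases groupLike_mem_or_mem_of_mem_sup (hS D hs.1) h2 hg hgs with h | h
    · exact ⟨D, hs.1, h⟩
    · exact ih hs.2 h

/-- `φ` is the projection of `C` onto `ℂ g` along a complementary subcoalgebra: `φ(g) = 1` and
`x₍₁₎ φ(x₍₂₎) = φ(x) g = φ(x₍₁₎) x₍₂₎`. -/
structure IsGroupLikeFunctional (g : C) (φ : C →ₗ[ℂ] ℂ) : Prop where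
  apply_self : φ g = 1
  right (x : C) : TensorProduct.rid ℂ C (φ.lTensor C (Coalgebra.comul x)) = φ x • g
  left (x : C) : TensorProduct.lid ℂ C (φ.rTensor C (Coalgebra.comul x)) = φ x • g

/-- Evaluating `φ ⊗ ψ` on `Δ(x)` in the two possible orders gives `ψ(x) φ(g) = φ(x) ψ(g)`. -/
theorem IsGroupLikeFunctional.unique {g : C} {φ ψ : C →ₗ[ℂ] ℂ} (hφ : IsGroupLikeFunctional g φ)
    (hψ : IsGroupLikeFunctional g ψ) : φ = ψ := by
  ext x
  have e : ∀ z : C ⊗[ℂ] C, φ (TensorProduct.rid ℂ C (ψ.lTensor C z)) =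
      ψ (TensorProduct.lid ℂ C (φ.rTensor C z)) := by
    intro z
    induction z with
    | zero => simp
    | add x y hx hy => simp only [map_add, hx, hy]
    | tmul x y => simp [mul_comm]
  have := e (Coalgebra.comul x)
  rw [hφ.left, hψ.right, map_smul, map_smul, hφ.apply_self, hψ.apply_self] at this
  simpa using this.symm

/-- On `Δ(h) = h ⊗ h` the defining identity reads `φ(h) h = φ(h) g`. -/
theorem IsGroupLikeFunctional.apply_of_ne {g h : C} (hh : IsGroupLikeElem ℂ h)
    {φ : C →ₗ[ℂ] ℂ} (hφ : IsGroupLikeFunctional g φ) (hne : h ≠ g) : φ h = 0 := by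
  have h1 := hφ.right h
  rw [hh.comul_eq_tmul_self] at h1
  by_contra hn
  refine hne (smul_right_injective C hn ?_)
  simpa using h1

/-- On a cosemisimple coalgebra, each grouplike element `g` has a functional that vanishes on
every simple subcoalgebra other than `ℂ g`. -/
theorem exists_isGroupLikeFunctional (hC : IsCosemisimple C) {g : C} (hg : IsGroupLikeElem ℂ g) :
    ∃ φ : C →ₗ[ℂ] ℂ, IsGroupLikeFunctional g φ ∧
      ∀ D, IsSimpleSubcoalgebra D → D ≠ ℂ ∙ g → ∀ x ∈ D, φ x = 0 := by
  let S : Set (Submodule ℂ C) := {D | IsSimpleSubcoalgebra D ∧ D ≠ ℂ ∙ g}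
  -- Otherwise a single simple `D` in `S` contains `g`, hence contains the subcoalgebra `ℂ g`, hence
  -- equals it; this case was excluded.
  have hgS : g ∉ sSup S := by
    intro h
    obtain ⟨D, hD, hgD⟩ := exists_mem_of_groupLike_mem_sSup (fun D hD => hD.1.1) hg h
    rcases hD.1.2.2 (ℂ ∙ g) ((Submodule.span_singleton_le_iff_mem _ _).2 hgD)
      (isSubcoalgebra_span_singleton hg) with h | h
    · exact hg.ne_zero (Submodule.span_singleton_eq_bot.1 h)
    · exact hD.2 h.symm
  obtain ⟨ψ, hψg, hψ⟩ := Submodule.exists_le_ker_of_notMem hgS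
  let φ := (ψ g)⁻¹ • ψ
  have h1 : φ g = 1 := inv_mul_cancel₀ hψg
  have h0 : ∀ D, IsSimpleSubcoalgebra D → D ≠ ℂ ∙ g → ∀ x ∈ D, φ x = 0 := by
    intro D hD hne x hx
    have : ψ x = 0 := hψ (le_sSup (show D ∈ S from ⟨hD, hne⟩) hx)
    simp [φ, this]
  -- By cosemisimplicity a linear map is determined on simple subcoalgebras, so both slice
  -- identities need checking only at `g` and on the simple `D ≠ ℂ g`.
  have key : ∀ f : C →ₗ[ℂ] C, f g = φ g • g →
      (∀ D, IsSimpleSubcoalgebra D → D ≠ ℂ ∙ g → ∀ x ∈ D, f x = 0) → ∀ x, f x = φ x • g := by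
    intro f hfg hf0 x
    have hle : (⊤ : Submodule ℂ C) ≤ LinearMap.eqLocus f (φ.smulRight g) := by
      rw [← hC]
      refine sSup_le fun D hD => ?_
      by_cases hne : D = ℂ ∙ g
      · subst hne
        rw [Submodule.span_singleton_le_iff_mem]
        exact hfg
      · intro x hx
        rw [LinearMap.mem_eqLocus, hf0 D hD hne x hx, LinearMap.smulRight_apply,
          h0 D hD hne x hx, zero_smul]
    exact hle (Submodule.mem_top : x ∈ ⊤)
  refine ⟨φ, ⟨h1, fun x => ?_, fun x => ?_⟩, h0⟩
  · refine key ((TensorProduct.rid ℂ C).toLinearMap ∘ₗ φ.lTensor C ∘ₗ Coalgebra.comul) ?_ ?_ x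
    · simp [hg.comul_eq_tmul_self]
    · intro D hD hne x hx
      simp [lTensor_eq_zero_of_mem_range (h0 D hD hne) (hD.1 x hx)]
  · refine key ((TensorProduct.lid ℂ C).toLinearMap ∘ₗ φ.rTensor C ∘ₗ Coalgebra.comul) ?_ ?_ x
    · simp [hg.comul_eq_tmul_self]
    · intro D hD hne x hx
      simp [rTensor_eq_zero_of_mem_range (h0 D hD hne) (hD.1 x hx)]

/-- On a cosemisimple coalgebra the grouplike functionals form a pointwise finite family. -/
theorem exists_groupLikeFunctionals (hC : IsCosemisimple C) :
    ∃ φ : C →ₗ[ℂ] (GroupLike ℂ C →₀ ℂ), ∀ g : GroupLike ℂ C,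
      IsGroupLikeFunctional g.val (Finsupp.lapply g ∘ₗ φ) := by
  choose φ hφ h0 using fun g : GroupLike ℂ C =>
    exists_isGroupLikeFunctional hC g.isGroupLikeElem_val
  let V : Submodule ℂ C :=
    { carrier := {x | (Function.support fun g => φ g x).Finite}
      zero_mem' := by simp
      add_mem' := fun {x y} hx hy => (hx.union hy).subset (by
        intro g hg
        by_contra hn
        simp only [Set.mem_union, Function.mem_support, not_or, not_not] at hn
        exact hg (by simp [hn.1, hn.2]))
      smul_mem' := fun c x hx => hx.subset (by
        intro g hg
        by_contra hn
        simp only [Function.mem_support, not_not] at hn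
        exact hg (by simp [hn])) }
  have hV : ∀ x, x ∈ V := by
    have hle : (⊤ : Submodule ℂ C) ≤ V := by
      rw [← hC]
      refine sSup_le fun D hD x hx => ?_
      -- On a simple `D` at most one functional is nonzero: `φ g x ≠ 0` with `x ∈ D` forces `D = ℂ
      -- g`, and there all other functionals vanish.
      refine Set.Subsingleton.finite fun g hg g' hg' => ?_
      have e : ∀ g : GroupLike ℂ C, φ g x ≠ 0 → D = ℂ ∙ g.val := fun g hg => by
        by_contra hne
        exact hg (h0 g D hD hne x hx)
      by_contra hne
      have hgD : x ∈ ℂ ∙ g.val := e g hg ▸ hx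
      obtain ⟨c, rfl⟩ := Submodule.mem_span_singleton.1 hgD
      refine hg' ?_
      simp [(hφ g').apply_of_ne g.isGroupLikeElem_val (fun h => hne (GroupLike.val_injective h))]
    exact fun x => hle Submodule.mem_top
  exact ⟨{
    toFun := fun x => Finsupp.ofSupportFinite (fun g => φ g x) (hV x)
    map_add' := fun x y => by ext g; exact map_add (φ g) x y
    map_smul' := fun c x => by ext g; exact map_smul (φ g) c x }, hφ⟩

end Functional

/-! ### Translation of the coordinate functionals by grouplikes -/

section Translate

variable {H : Type v} [Ring H] [HopfAlgebra ℂ H]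

/-- Because `Δ(d x) = (d ⊗ d) Δ(x)`, the identities for `φ` at `d x`, multiplied by `d⁻¹`, are those
of the translate at `x`. Together with uniqueness this gives `φ_g(d x) = φ_{d⁻¹ g}(x)`. -/
theorem IsGroupLikeFunctional.comp_mulLeft {g : GroupLike ℂ H} {φ : H →ₗ[ℂ] ℂ}
    (hφ : IsGroupLikeFunctional g.val φ) (d : GroupLike ℂ H) :
    IsGroupLikeFunctional (d⁻¹ * g).val (φ ∘ₗ LinearMap.mulLeft ℂ d.val) := by
  have hc : ∀ x, Coalgebra.comul (R := ℂ) (d.val * x) = (d.val ⊗ₜ d.val) * Coalgebra.comul x := by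
    intro x
    rw [Bialgebra.comul_mul, d.isGroupLikeElem_val.comul_eq_tmul_self]
  have hd : (d⁻¹).val * d.val = 1 := by rw [← GroupLike.val_mul, inv_mul_cancel]; rfl
  have hd' : d.val * (d⁻¹).val = 1 := by rw [← GroupLike.val_mul, mul_inv_cancel]; rfl
  refine ⟨?_, fun x => ?_, fun x => ?_⟩
  · rw [GroupLike.val_mul, LinearMap.comp_apply, LinearMap.mulLeft_apply, ← mul_assoc, hd',
      one_mul, hφ.apply_self]
  · have e : ∀ z : H ⊗[ℂ] H, TensorProduct.rid ℂ H
        ((φ ∘ₗ LinearMap.mulLeft ℂ d.val).lTensor H z) =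
        (d⁻¹).val * TensorProduct.rid ℂ H (φ.lTensor H ((d.val ⊗ₜ d.val) * z)) := by
      intro z
      induction z with
      | zero => simp
      | add x y hx hy => simp only [map_add, mul_add, hx, hy]
      | tmul x y => simp only [LinearMap.lTensor_tmul, LinearMap.comp_apply,
          LinearMap.mulLeft_apply, TensorProduct.rid_tmul, Algebra.TensorProduct.tmul_mul_tmul,
          mul_smul_comm, ← mul_assoc, hd, one_mul]
    rw [e, ← hc, hφ.right, mul_smul_comm]; rfl
  · have e : ∀ z : H ⊗[ℂ] H, TensorProduct.lid ℂ H
        ((φ ∘ₗ LinearMap.mulLeft ℂ d.val).rTensor H z) =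
        (d⁻¹).val * TensorProduct.lid ℂ H (φ.rTensor H ((d.val ⊗ₜ d.val) * z)) := by
      intro z
      induction z with
      | zero => simp
      | add x y hx hy => simp only [map_add, mul_add, hx, hy]
      | tmul x y => simp only [LinearMap.rTensor_tmul, LinearMap.comp_apply,
          LinearMap.mulLeft_apply, TensorProduct.lid_tmul, Algebra.TensorProduct.tmul_mul_tmul,
          mul_smul_comm, ← mul_assoc, hd, one_mul]
    rw [e, ← hc, hφ.left, mul_smul_comm]; rfl

end Translate

/-! ### Slice maps -/

section Slice

variable {A : Type u} [Ring A] [Algebra ℂ A] {K : Type v} [Ring K] [Algebra ℂ K]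

/-- The slice map `a ⊗ h ↦ φ(h) a`. -/
def slice (φ : K →ₗ[ℂ] ℂ) : A ⊗[ℂ] K →ₗ[ℂ] A :=
  (TensorProduct.rid ℂ A).toLinearMap ∘ₗ φ.lTensor A

@[simp]
theorem slice_tmul (φ : K →ₗ[ℂ] ℂ) (a : A) (h : K) : slice φ (a ⊗ₜ h) = φ h • a := by
  simp [slice]

theorem slice_mul_tmul_one (φ : K →ₗ[ℂ] ℂ) (z : A ⊗[ℂ] K) (y : A) :
    slice φ (z * (y ⊗ₜ 1)) = slice φ z * y := by
  induction z with
  | zero => simp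
  | add z z' h h' => simp only [map_add, add_mul, h, h']
  | tmul a h => simp

end Slice

/-! ### Projections onto weight spaces and the antipode identity -/

section Hit

variable {A : Type u} [Ring A] [HopfAlgebra ℂ A] {H : Type v} [Ring H] [HopfAlgebra ℂ H]
variable (π : A →ₐc[ℂ] H)

theorem rightCoaction_apply (a : A) :
    rightCoaction π a = (π : A →ₐ[ℂ] H).toLinearMap.lTensor A (Coalgebra.comul a) := rfl

/-- `(ρ ⊗ id) ρ = (id ⊗ Δ) ρ` for the right coaction `ρ`. -/
theorem rightCoaction_coassoc (a : A) :
    (rightCoaction π).toLinearMap.rTensor H (rightCoaction π a) =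
      (TensorProduct.assoc ℂ A H H).symm (Coalgebra.comul.lTensor A (rightCoaction π a)) := by
  let p : A →ₗ[ℂ] H := (π : A →ₐ[ℂ] H).toLinearMap
  have hp : Coalgebra.comul ∘ₗ p = TensorProduct.map p p ∘ₗ Coalgebra.comul := by
    ext x; exact (CoalgHomClass.map_comp_comul_apply π x).symm
  have h1 : ∀ z : A ⊗[ℂ] A, (rightCoaction π).toLinearMap.rTensor H (p.lTensor A z) =
      (TensorProduct.assoc ℂ A H H).symm ((TensorProduct.map p p).lTensor A
        (TensorProduct.assoc ℂ A A A (Coalgebra.comul.rTensor A z))) := by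
    intro z
    induction z with
    | zero => simp
    | add x y hx hy => simp only [map_add, hx, hy]
    | tmul x y =>
      simp only [LinearMap.lTensor_tmul, LinearMap.rTensor_tmul, AlgHom.toLinearMap_apply,
        rightCoaction_apply]
      generalize Coalgebra.comul (R := ℂ) x = t
      induction t with
      | zero => simp
      | add x y hx hy => simp only [map_add, add_tmul, hx, hy]
      | tmul x z => rfl
  rw [rightCoaction_apply]
  refine (h1 _).trans ?_
  rw [Coalgebra.coassoc_apply, ← LinearMap.comp_apply ((TensorProduct.map p p).lTensor A),
    ← LinearMap.lTensor_comp, ← hp, LinearMap.lTensor_comp, LinearMap.comp_apply]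

theorem lid_counit_rightCoaction (a : A) :
    TensorProduct.lid ℂ H (Coalgebra.counit.rTensor H (rightCoaction π a)) = π a := by
  have e : ∀ x : A ⊗[ℂ] A, TensorProduct.lid ℂ H (Coalgebra.counit.rTensor H
      ((π : A →ₐ[ℂ] H).toLinearMap.lTensor A x)) =
      π (TensorProduct.lid ℂ A (Coalgebra.counit.rTensor A x)) := by
    intro x
    induction x with
    | zero => simp
    | add x x' hx hx' => simp only [map_add, hx, hx']
    | tmul p q => simp
  rw [rightCoaction_apply, e, Coalgebra.rTensor_counit_comul]
  simp

/-- The right translation `a ↦ a₍₁₎ φ(π(a₍₂₎))`. -/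
def hit (φ : H →ₗ[ℂ] ℂ) : A →ₗ[ℂ] A := slice φ ∘ₗ (rightCoaction π).toLinearMap

theorem hit_apply (φ : H →ₗ[ℂ] ℂ) (a : A) : hit π φ a = slice φ (rightCoaction π a) := rfl

theorem hit_counit (a : A) : hit π Coalgebra.counit a = a := by
  have e : ∀ x : A ⊗[ℂ] A, slice Coalgebra.counit ((π : A →ₐ[ℂ] H).toLinearMap.lTensor A x) =
      TensorProduct.rid ℂ A (Coalgebra.counit.lTensor A x) := by
    intro x
    induction x with
    | zero => simp
    | add x x' hx hx' => simp only [map_add, hx, hx']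
    | tmul p q => simp
  rw [hit_apply, rightCoaction_apply, e, Coalgebra.lTensor_counit_comul]
  simp

/-- This controls the counit of projected elements: it yields weight vectors of counit `1` and
elements of `B⁺`. -/
theorem counit_hit (φ : H →ₗ[ℂ] ℂ) (a : A) :
    Coalgebra.counit (R := ℂ) (hit π φ a) = φ (π a) := by
  have e : ∀ x : A ⊗[ℂ] H, Coalgebra.counit (R := ℂ) (slice φ x) =
      φ (TensorProduct.lid ℂ H (Coalgebra.counit.rTensor H x)) := by
    intro x
    induction x with
    | zero => simp
    | add x x' hx hx' => simp only [map_add, hx, hx']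
    | tmul p q => simp [mul_comm]
  rw [hit_apply, e, lid_counit_rightCoaction]

variable {π}

theorem hit_of_mem_weightSpace (φ : H →ₗ[ℂ] ℂ) {g : H} {a : A} (ha : a ∈ weightSpace π g) :
    hit π φ a = φ g • a := by
  rw [hit_apply, mem_weightSpace.1 ha, slice_tmul]

theorem map_of_mem_weightSpace {g : H} {a : A} (ha : a ∈ weightSpace π g) :
    π a = Coalgebra.counit (R := ℂ) a • g := by
  rw [← lid_counit_rightCoaction, mem_weightSpace.1 ha]
  simp

theorem mul_mem_weightSpace {g h : H} {a b : A} (ha : a ∈ weightSpace π g)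
    (hb : b ∈ weightSpace π h) : a * b ∈ weightSpace π (g * h) := by
  rw [mem_weightSpace] at *
  rw [map_mul, ha, hb, Algebra.TensorProduct.tmul_mul_tmul]

variable (π) in
theorem weightSpace_one : weightSpace π 1 = Subalgebra.toSubmodule (Base π) := rfl

theorem hit_mul_base (φ : H →ₗ[ℂ] ℂ) (a : A) {b : A} (hb : b ∈ Base π) :
    hit π φ (a * b) = hit π φ a * b := by
  rw [hit_apply, map_mul, mem_coinvariants.1 hb, slice_mul_tmul_one, hit_apply]

theorem rightCoaction_slice (φ : H →ₗ[ℂ] ℂ) (z : A ⊗[ℂ] H) :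
    rightCoaction π (slice φ z) = TensorProduct.rid ℂ (A ⊗[ℂ] H)
      (φ.lTensor (A ⊗[ℂ] H) ((rightCoaction π).toLinearMap.rTensor H z)) := by
  induction z with
  | zero => simp
  | add x x' hx hx' => simp only [map_add, hx, hx']
  | tmul a h => simp

/-- By coassociativity, applying `ρ` to the slice of `ρ(a)` slices `Δ` in the `H`-leg instead, where
`(id ⊗ φ) Δ = φ(·) g`. -/
theorem hit_mem_weightSpace {g : H} {φ : H →ₗ[ℂ] ℂ} (hφ : IsGroupLikeFunctional g φ) (a : A) :
    hit π φ a ∈ weightSpace π g := by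
  have e : ∀ z : A ⊗[ℂ] (H ⊗[ℂ] H), TensorProduct.rid ℂ (A ⊗[ℂ] H) (φ.lTensor (A ⊗[ℂ] H)
      ((TensorProduct.assoc ℂ A H H).symm z)) =
      ((TensorProduct.rid ℂ H).toLinearMap ∘ₗ φ.lTensor H).lTensor A z := by
    intro z
    induction z with
    | zero => simp
    | add x x' hx hx' => simp only [map_add, hx, hx']
    | tmul a z =>
      induction z with
      | zero => simp
      | add x x' hx hx' => simp only [map_add, tmul_add, hx, hx']
      | tmul x y => simp [TensorProduct.tmul_smul]
  have hφ' : ((TensorProduct.rid ℂ H).toLinearMap ∘ₗ φ.lTensor H) ∘ₗ Coalgebra.comul =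
      φ.smulRight g := by ext x; exact hφ.right x
  have e' : ∀ z : A ⊗[ℂ] H, (φ.smulRight g).lTensor A z = slice φ z ⊗ₜ g := by
    intro z
    induction z with
    | zero => simp
    | add x x' hx hx' => simp only [map_add, add_tmul, hx, hx']
    | tmul a h => simp [TensorProduct.smul_tmul]
  rw [mem_weightSpace, hit_apply, rightCoaction_slice, rightCoaction_coassoc, e,
    ← LinearMap.comp_apply, ← LinearMap.lTensor_comp, hφ', e']

variable (π) in
/-- `ρ(S(t₍₁₎)) (t₍₂₎ ⊗ 1) = 1 ⊗ π(S(t))` for the right coaction `ρ`. -/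
theorem rightCoaction_antipode_conv :
    toConv ((rightCoaction π).toLinearMap ∘ₗ HopfAlgebra.antipode ℂ) *
      toConv (Algebra.TensorProduct.includeLeft : A →ₐ[ℂ] A ⊗[ℂ] H).toLinearMap =
    toConv (((Algebra.TensorProduct.includeRight : H →ₐ[ℂ] A ⊗[ℂ] H).comp
      (π : A →ₐ[ℂ] H)).toLinearMap ∘ₗ HopfAlgebra.antipode ℂ) := by
  -- After convolving on the right with `1 ⊗ π`, both sides are the unit: on the left `(· ⊗ 1) * (1
  -- ⊗ π) = ρ`, and `ρ ∘ S` is the convolution inverse of `ρ`.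
  apply conv_cancel ((Algebra.TensorProduct.includeRight : H →ₐ[ℂ] A ⊗[ℂ] H).comp
    (π : A →ₐ[ℂ] H))
  rw [conv_inv_left, mul_assoc]
  exact (congrArg _ (rightCoaction_conv π).symm).trans (conv_inv_left (rightCoaction π))

variable (π) in
/-- `ρ_φ(a S(t₍₁₎)) t₍₂₎ = (id ⊗ φ)(ρ(a) (1 ⊗ π(S(t))))`, where `ρ_φ` is `hit π φ`. -/
theorem hit_mul_antipode (φ : H →ₗ[ℂ] ℂ) (a t : A) :
    LinearMap.mul' ℂ A ((hit π φ ∘ₗ LinearMap.mulLeft ℂ a ∘ₗ HopfAlgebra.antipode ℂ).rTensor A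
      (Coalgebra.comul t)) =
    slice φ (rightCoaction π a * (1 ⊗ₜ π (HopfAlgebra.antipode ℂ t))) := by
  have h : LinearMap.mul' ℂ (A ⊗[ℂ] H) (TensorProduct.map
      ((rightCoaction π).toLinearMap ∘ₗ HopfAlgebra.antipode ℂ)
      (Algebra.TensorProduct.includeLeft : A →ₐ[ℂ] A ⊗[ℂ] H).toLinearMap (Coalgebra.comul t)) =
      1 ⊗ₜ π (HopfAlgebra.antipode ℂ t) :=
    congrArg (fun f => f.ofConv t) (rightCoaction_antipode_conv π)
  have e : ∀ z : A ⊗[ℂ] A, LinearMap.mul' ℂ A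
      ((hit π φ ∘ₗ LinearMap.mulLeft ℂ a ∘ₗ HopfAlgebra.antipode ℂ).rTensor A z) =
      slice φ (rightCoaction π a * LinearMap.mul' ℂ (A ⊗[ℂ] H) (TensorProduct.map
        ((rightCoaction π).toLinearMap ∘ₗ HopfAlgebra.antipode ℂ)
        (Algebra.TensorProduct.includeLeft : A →ₐ[ℂ] A ⊗[ℂ] H).toLinearMap z)) := by
    intro z
    induction z with
    | zero => simp
    | add x x' hx hx' => simp only [map_add, mul_add, hx, hx']
    | tmul x y =>
      have : slice φ (rightCoaction π a * (rightCoaction π (HopfAlgebra.antipode ℂ x) *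
          (y ⊗ₜ 1))) = hit π φ (a * HopfAlgebra.antipode ℂ x) * y := by
        rw [← mul_assoc, slice_mul_tmul_one, hit_apply, map_mul (rightCoaction π)]
      exact this.symm
  rw [e, h]

/-- For `a` of weight `g`, `ρ_φ(a S(t₍₁₎)) t₍₂₎ = φ(g π(S(t))) a`. -/
theorem hit_mul_antipode_of_mem_weightSpace (φ : H →ₗ[ℂ] ℂ) {g : H} {a : A}
    (ha : a ∈ weightSpace π g) (t : A) :
    LinearMap.mul' ℂ A ((hit π φ ∘ₗ LinearMap.mulLeft ℂ a ∘ₗ HopfAlgebra.antipode ℂ).rTensor A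
      (Coalgebra.comul t)) = φ (g * π (HopfAlgebra.antipode ℂ t)) • a := by
  rw [hit_mul_antipode, mem_weightSpace.1 ha, Algebra.TensorProduct.tmul_mul_tmul, mul_one,
    slice_tmul]

end Hit

/-! ### The strong grading of the total algebra -/

section Grading

variable {A : Type u} [Ring A] [HopfAlgebra ℂ A] {H : Type v} [Ring H] [HopfAlgebra ℂ H]
variable {π : A →ₐc[ℂ] H}

variable (π) in
-- Membership in `P` is automatic because `γ` becomes `1` in `K_H`. Later arguments therefore work
-- with weight spaces.
theorem component_eq_weightSpace (γ : GroupLike ℂ H) : component π γ = weightSpace π γ.val :=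
  inf_eq_right.2 (weightSpace_le_total π γ)

variable (π) in
theorem component_one : component π 1 = Subalgebra.toSubmodule (Base π) :=
  (component_eq_weightSpace π 1).trans (weightSpace_one π)

/-- Lift `γ` to `A` and project the lift to the weight space; its counit becomes `φ(γ) = 1`. -/
theorem exists_mem_weightSpace_counit_eq_one (hH : IsCosemisimple H) (hπ : Function.Surjective π)
    (γ : GroupLike ℂ H) : ∃ a ∈ weightSpace π γ.val, Coalgebra.counit (R := ℂ) a = 1 := by
  obtain ⟨φ, hφ, -⟩ := exists_isGroupLikeFunctional hH γ.isGroupLikeElem_val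
  obtain ⟨a, ha⟩ := hπ γ.val
  exact ⟨hit π φ a, hit_mem_weightSpace hφ a, by rw [counit_hit, ha, hφ.apply_self]⟩

theorem map_component (hH : IsCosemisimple H) (hπ : Function.Surjective π) (γ : GroupLike ℂ H) :
    (component π γ).map (π : A →ₐ[ℂ] H).toLinearMap = ℂ ∙ γ.val := by
  rw [component_eq_weightSpace]
  apply le_antisymm
  · rintro _ ⟨a, ha, rfl⟩
    exact Submodule.mem_span_singleton.2 ⟨_, (map_of_mem_weightSpace ha).symm⟩
  · rw [Submodule.span_singleton_le_iff_mem]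
    obtain ⟨a, ha, h1⟩ := exists_mem_weightSpace_counit_eq_one hH hπ γ
    refine ⟨a, ha, ?_⟩
    have := map_of_mem_weightSpace ha
    rw [h1, one_smul] at this
    exact this

variable (π) in
/-- A Hopf algebra map commutes with the antipodes. -/
theorem map_antipode_apply (a : A) :
    π (HopfAlgebra.antipode ℂ a) = HopfAlgebra.antipode ℂ (π a) := by
  have h : toConv ((π : A →ₐ[ℂ] H).toLinearMap ∘ₗ HopfAlgebra.antipode ℂ) =
      toConv (HopfAlgebra.antipode ℂ ∘ₗ (π : A →ₐ[ℂ] H).toLinearMap) := by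
    apply conv_cancel (π : A →ₐ[ℂ] H)
    rw [conv_inv_left]
    have := LinearMap.convMul_comp_coalgHom_distrib (toConv (HopfAlgebra.antipode ℂ (A := H)))
      (toConv LinearMap.id) (π : A →ₗc[ℂ] H)
    rw [LinearMap.antipode_mul_id] at this
    apply WithConv.ext
    refine Eq.trans ?_ this
    ext a
    simp
  exact congrArg (fun f => f.ofConv a) h

theorem map_antipode_of_mem_weightSpace {γ : GroupLike ℂ H} {a : A}
    (ha : a ∈ weightSpace π γ.val) :
    π (HopfAlgebra.antipode ℂ a) = Coalgebra.counit (R := ℂ) a • (γ⁻¹).val := by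
  rw [map_antipode_apply, map_of_mem_weightSpace ha, map_smul, GroupLike.val_inv]

/-- For `t` of weight `γ⁻¹` and counit `1`, the antipode identity at `a = 1` reads `∑ hit_φ(S(t₍₁₎))
t₍₂₎ = φ(γ) = 1`. The first factors have weight `γ`; the `t₍₂₎` have weight `γ⁻¹`, as weight spaces
are left coideals. -/
theorem one_mem_weightSpace_mul (hH : IsCosemisimple H) (hπ : Function.Surjective π)
    (γ : GroupLike ℂ H) : (1 : A) ∈ weightSpace π γ.val * weightSpace π (γ⁻¹).val := by
  obtain ⟨φ, hφ, -⟩ := exists_isGroupLikeFunctional hH γ.isGroupLikeElem_val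
  obtain ⟨t, ht, ht1⟩ := exists_mem_weightSpace_counit_eq_one hH hπ γ⁻¹
  have h1 : (1 : A) ∈ weightSpace π (1 : H) := by
    rw [weightSpace_one]; exact (Base π).one_mem
  have h := hit_mul_antipode_of_mem_weightSpace φ h1 t
  rw [map_antipode_of_mem_weightSpace ht, ht1, one_smul, one_mul, inv_inv, hφ.apply_self,
    one_smul] at h
  rw [← h]
  obtain ⟨z, hz⟩ := comul_mem_of_mem_weightSpace π _ ht
  rw [← hz]
  clear hz h
  induction z with
  | zero => simp
  | add x y hx hy => simp only [map_add]; exact Submodule.add_mem _ hx hy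
  | tmul x y =>
    simp only [LinearMap.lTensor_tmul, LinearMap.rTensor_tmul, LinearMap.mul'_apply]
    exact Submodule.mul_mem_mul (hit_mem_weightSpace hφ _) y.2

/-- For the reverse inclusion, insert `1 ∈ E_γ E_{γ⁻¹}` in front of `a` and use `E_{γ⁻¹} E_{γγ'} ⊆
E_{γ'}`. -/
theorem component_mul_component (hH : IsCosemisimple H) (hπ : Function.Surjective π)
    (γ γ' : GroupLike ℂ H) : component π γ * component π γ' = component π (γ * γ') := by
  simp only [component_eq_weightSpace]
  apply le_antisymm
  · rw [Submodule.mul_le]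
    exact fun a ha b hb => mul_mem_weightSpace ha hb
  · intro a ha
    have h := Submodule.mul_mem_mul (one_mem_weightSpace_mul hH hπ γ) ha
    rw [one_mul, mul_assoc] at h
    refine mul_le_mul_right (a := weightSpace π γ.val) ?_ h
    rw [Submodule.mul_le]
    intro x hx y hy
    have := mul_mem_weightSpace hx hy
    rwa [← GroupLike.val_mul, inv_mul_cancel_left] at this

/-- The projection attached to `φ_γ` is the identity on `E_γ` and zero on every other component. -/
theorem iSupIndep_component (hH : IsCosemisimple H) : iSupIndep (component π) := by
  intro γ
  obtain ⟨φ, hφ, -⟩ := exists_isGroupLikeFunctional hH γ.isGroupLikeElem_val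
  rw [Submodule.disjoint_def]
  intro x hx hx'
  rw [component_eq_weightSpace] at hx
  have hle : (⨆ δ, ⨆ (_ : δ ≠ γ), component π δ) ≤ LinearMap.ker (hit π φ) := by
    refine iSup₂_le fun δ hδ y hy => ?_
    rw [component_eq_weightSpace] at hy
    rw [LinearMap.mem_ker, hit_of_mem_weightSpace φ hy,
      hφ.apply_of_ne δ.isGroupLikeElem_val (fun h => hδ (GroupLike.val_injective h)), zero_smul]
  have h0 : hit π φ x = 0 := hle hx'
  rwa [hit_of_mem_weightSpace φ hx, hφ.apply_self, one_smul] at h0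

/-- The total grouplike functional is invariant under multiplication by grouplike elements. -/
theorem sum_groupLikeFunctionals_mul {φ : H →ₗ[ℂ] (GroupLike ℂ H →₀ ℂ)}
    (hφ : ∀ g : GroupLike ℂ H, IsGroupLikeFunctional g.val (Finsupp.lapply g ∘ₗ φ))
    (d : GroupLike ℂ H) (x : H) :
    Finsupp.linearCombination ℂ (fun _ => (1 : ℂ)) (φ (d.val * x)) =
      Finsupp.linearCombination ℂ (fun _ => (1 : ℂ)) (φ x) := by
  -- Left translation by `d` only permutes the coordinates, so their sum does not change.
  have h : φ (d.val * x) = Finsupp.mapDomain (Equiv.mulLeft d) (φ x) := by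
    ext g
    rw [Finsupp.mapDomain_equiv_apply]
    have := ((hφ g).comp_mulLeft d).unique (hφ (d⁻¹ * g))
    exact congrArg (fun f => f x) this
  rw [h, Finsupp.linearCombination_mapDomain]
  rfl

/-- The sum `σ` of all coordinate functionals factors through `K_H`, so its operator fixes `P`
pointwise; expanding `σ` writes `p` as a finite sum of its projections to the components. -/
theorem mem_iSup_component_of_mem_total (hH : IsCosemisimple H)
    (hcentral : ∀ γ : GroupLike ℂ H, γ.val ∈ Set.center H) {p : A} (hp : p ∈ Total π) :
    p ∈ ⨆ γ, component π γ := by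
  obtain ⟨φ, hφ⟩ := exists_groupLikeFunctionals hH
  let σ : H →ₗ[ℂ] ℂ := Finsupp.linearCombination ℂ (fun _ => (1 : ℂ)) ∘ₗ φ
  have hσ1 : σ 1 = 1 := by
    have : φ 1 = Finsupp.single 1 1 := by
      ext g
      by_cases hg : 1 = g
      · subst hg; simpa using (hφ 1).apply_self
      · rw [Finsupp.single_eq_of_ne (Ne.symm hg)]
        exact (hφ g).apply_of_ne (GroupLike.isGroupLikeElem_val 1)
          (fun h => hg (GroupLike.val_injective h))
    simp [σ, this]
  have hσ : ∀ x ∈ groupLikeIdeal H, σ x = 0 := by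
    intro x hx
    -- The two-sided form is stable under multiplication on either side. On generators, centrality
    -- gives `a (g - 1) b = g (a b) - a b`, which translation invariance of `σ` kills.
    have := groupLikeIdeal_induction (p := fun x => ∀ a b, σ (a * x * b) = 0)
      ?_ ?_ ?_ ?_ ?_ ?_ hx 1 1
    · simpa using this
    · intro g a b
      have hc : a * (g.val - 1) * b = g.val * (a * b) - a * b := by
        rw [mul_sub, mul_one, sub_mul, ((hcentral g).comm a).symm.eq, mul_assoc]
      rw [hc, map_sub, sub_eq_zero]
      exact sum_groupLikeFunctionals_mul hφ g _
    · simp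
    · intro x y hx hy a b
      rw [mul_add, add_mul, map_add, hx, hy, add_zero]
    · intro x hx a b
      rw [mul_neg, neg_mul, map_neg, hx, neg_zero]
    · intro c x hx a b
      rw [← mul_assoc a]; exact hx _ _
    · intro x c hx a b
      rw [← mul_assoc a, mul_assoc (a * x)]; exact hx _ _
  have hp' : hit π σ p = p := by
    let q : H →ₗ[ℂ] KH H := (projK H : H →ₐ[ℂ] KH H).toLinearMap
    have hq : Function.Surjective q := Ideal.Quotient.mk_surjective
    -- A linear section of `H → K_H` realises the functional induced by `σ` on `K_H` as `σ ∘ s`, to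
    -- which coinvariance of `p` applies.
    obtain ⟨s, hs⟩ := q.exists_rightInverse_of_surjective (LinearMap.range_eq_top.2 hq)
    have hσq : (σ ∘ₗ s) ∘ₗ q = σ := by
      ext x
      have h0 : q (s (q x) - x) = 0 := by
        rw [map_sub, sub_eq_zero]; exact congrArg (fun f => f (q x)) hs
      have := hσ _ (Ideal.Quotient.eq_zero_iff_mem.1 h0)
      rwa [map_sub, sub_eq_zero] at this
    have e : ∀ x : A ⊗[ℂ] A, slice σ ((π : A →ₐ[ℂ] H).toLinearMap.lTensor A x) =
        slice (σ ∘ₗ s) ((((projK H).comp π : A →ₐc[ℂ] KH H) :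
          A →ₐ[ℂ] KH H).toLinearMap.lTensor A x) := by
      intro x
      induction x with
      | zero => simp
      | add x y hx hy => simp only [map_add, hx, hy]
      | tmul x y =>
        simp only [LinearMap.lTensor_tmul, slice_tmul]
        exact congrArg (fun f : H →ₗ[ℂ] ℂ => f (π y) • x) hσq.symm
    have h1 : (σ ∘ₗ s) 1 = 1 := by
      have : q 1 = 1 := map_one (projK H)
      rw [← this, ← hσ1]
      exact congrArg (fun f : H →ₗ[ℂ] ℂ => f 1) hσq
    rw [hit_apply, rightCoaction_apply, e, ← rightCoaction_apply, mem_coinvariants.1 hp,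
      slice_tmul, h1, one_smul]
  -- `σ` is a sum of functionals that is finite only pointwise; on each tensor the family of slices
  -- still has finite support.
  have hsum : ∀ z : A ⊗[ℂ] H, ∃ f : GroupLike ℂ H →₀ A,
      (∀ γ, f γ = slice (Finsupp.lapply γ ∘ₗ φ) z) ∧ slice σ z = f.sum fun _ a => a := by
    intro z
    induction z with
    | zero => exact ⟨0, by simp, by simp⟩
    | add x y hx hy =>
      obtain ⟨f, hf, hf'⟩ := hx
      obtain ⟨g, hg, hg'⟩ := hy
      refine ⟨f + g, fun γ => by simp [hf, hg], ?_⟩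
      rw [map_add, hf', hg', Finsupp.sum_add_index' (fun _ => rfl) (fun _ _ _ => rfl)]
    | tmul a h =>
      refine ⟨(φ h).mapRange (fun c => c • a) (zero_smul ℂ a), fun γ => by simp, ?_⟩
      rw [Finsupp.sum_mapRange_index (fun _ => rfl), slice_tmul]
      simp [σ, Finsupp.linearCombination_apply, Finsupp.sum, Finset.sum_smul]
  obtain ⟨f, hf, hf'⟩ := hsum (rightCoaction π p)
  rw [← hp', hit_apply, hf']
  refine Submodule.sum_mem _ fun γ _ => Submodule.mem_iSup_of_mem γ ?_
  rw [component_eq_weightSpace, hf]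
  exact hit_mem_weightSpace (hφ γ) p

theorem iSup_component (hH : IsCosemisimple H)
    (hcentral : ∀ γ : GroupLike ℂ H, γ.val ∈ Set.center H) :
    (⨆ γ, component π γ) = Subalgebra.toSubmodule (Total π) :=
  le_antisymm (iSup_le fun _ => inf_le_left) fun _ hp => mem_iSup_component_of_mem_total hH hcentral hp

end Grading

/-! ### The kernel of `π` is `B⁺ A` -/

section Kernel

variable {A : Type u} [Ring A] [HopfAlgebra ℂ A] {H : Type v} [Ring H] [HopfAlgebra ℂ H]
variable {π : A →ₐc[ℂ] H}

theorem hit_mem_base {φ : H →ₗ[ℂ] ℂ} (hφ : IsGroupLikeFunctional (1 : H) φ) (a : A) :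
    hit π φ a ∈ Base π := hit_mem_weightSpace hφ a

variable (π) in
theorem map_eq_zero_of_mem_augmentationIdeal {a : A} (ha : a ∈ augmentationIdeal π) :
    π a = 0 := by
  have : augmentationIdeal π ≤ LinearMap.ker (π : A →ₐ[ℂ] H).toLinearMap := by
    refine Submodule.span_le.2 ?_
    rintro _ ⟨b, hb, a, h0, rfl⟩
    have h := map_base (π := π) ⟨b, hb⟩
    simp only [h0, map_zero] at h
    change π (b * a) = 0
    rw [map_mul, h, zero_mul]
  exact this ha

/-- With `h = π(m)` the slice equals `∑ hit_φ(a S(m₍₁₎)) m₍₂₎`. Each first factor lies in `B` and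
has counit `φ(π(a) π(S(m₍₁₎))) = 0`. -/
theorem slice_mem_augmentationIdeal (hπ : Function.Surjective π) {φ : H →ₗ[ℂ] ℂ}
    (hφ : IsGroupLikeFunctional (1 : H) φ) {a : A} (ha : π a = 0) (h : H) :
    slice φ (rightCoaction π a * (1 ⊗ₜ HopfAlgebra.antipode ℂ h)) ∈ augmentationIdeal π := by
  obtain ⟨m, rfl⟩ := hπ h
  rw [← map_antipode_apply, ← hit_mul_antipode]
  generalize Coalgebra.comul (R := ℂ) m = z
  induction z with
  | zero => simp
  | add x y hx hy => simp only [map_add]; exact Submodule.add_mem _ hx hy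
  | tmul x y =>
    refine Submodule.subset_span ⟨_, hit_mem_base hφ (a * HopfAlgebra.antipode ℂ x), y, ?_, rfl⟩
    rw [counit_hit, map_mul, ha, zero_mul, map_zero]

/-- `(id ⊗ φ)(ρ(x₍₀₎) (1 ⊗ S(x₍₁₎))) = x` for the right coaction `ρ(x) = x₍₀₎ ⊗ x₍₁₎`. -/
theorem slice_rightCoaction_antipode {φ : H →ₗ[ℂ] ℂ} (hφ : φ 1 = 1) (x : A) :
    slice φ (LinearMap.mul' ℂ (A ⊗[ℂ] H) (TensorProduct.map (rightCoaction π).toLinearMap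
      ((Algebra.TensorProduct.includeRight : H →ₐ[ℂ] A ⊗[ℂ] H).toLinearMap ∘ₗ
        HopfAlgebra.antipode ℂ) (rightCoaction π x))) = x := by
  let ν : H ⊗[ℂ] H →ₗ[ℂ] H := LinearMap.mul' ℂ H ∘ₗ (HopfAlgebra.antipode ℂ).lTensor H
  have h1 : ∀ z : A ⊗[ℂ] H, LinearMap.mul' ℂ (A ⊗[ℂ] H) (TensorProduct.map
      (rightCoaction π).toLinearMap
      ((Algebra.TensorProduct.includeRight : H →ₐ[ℂ] A ⊗[ℂ] H).toLinearMap ∘ₗ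
        HopfAlgebra.antipode ℂ) z) =
      ν.lTensor A (TensorProduct.assoc ℂ A H H ((rightCoaction π).toLinearMap.rTensor H z)) := by
    intro z
    induction z with
    | zero => simp
    | add x y hx hy => simp only [map_add, hx, hy]
    | tmul a h =>
      simp only [TensorProduct.map_tmul, LinearMap.rTensor_tmul, LinearMap.mul'_apply,
        AlgHom.toLinearMap_apply]
      generalize rightCoaction π a = t
      induction t with
      | zero => simp
      | add x y hx hy => simp only [map_add, add_tmul, add_mul, hx, hy]
      | tmul x y => simp [ν]
  have h2 : ν ∘ₗ Coalgebra.comul = Algebra.linearMap ℂ H ∘ₗ Coalgebra.counit :=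
    HopfAlgebra.mul_antipode_lTensor_comul
  have h3 : ∀ z : A ⊗[ℂ] H, slice φ ((Algebra.linearMap ℂ H ∘ₗ Coalgebra.counit).lTensor A z) =
      slice Coalgebra.counit z := by
    intro z
    induction z with
    | zero => simp
    | add x y hx hy => simp only [map_add, hx, hy]
    | tmul a h => simp [Algebra.algebraMap_eq_smul_one, hφ]
  rw [h1, rightCoaction_coassoc, LinearEquiv.apply_symm_apply,
    ← LinearMap.lTensor_comp_apply, h2, h3, ← hit_apply, hit_counit]

/-- `ker π = B⁺ A`. -/
theorem mem_augmentationIdeal_iff (hH : IsCosemisimple H) (hπ : Function.Surjective π) (a : A) :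
    a ∈ augmentationIdeal π ↔ π a = 0 := by
  refine ⟨map_eq_zero_of_mem_augmentationIdeal π, fun ha => ?_⟩
  obtain ⟨φ, hφ, -⟩ := exists_isGroupLikeFunctional hH (IsGroupLikeElem.one (R := ℂ) (A := H))
  let p : A →ₗ[ℂ] H := (π : A →ₐ[ℂ] H).toLinearMap
  -- `(π ⊗ id) ρ(a) = Δ(π(a)) = 0`, so exactness puts `ρ(a)` in `ker π ⊗ H`. The formula rebuilding
  -- `a` from `ρ(a)` then reduces the claim to `slice_mem_augmentationIdeal`.
  have h0 : p.rTensor H (rightCoaction π a) = 0 := by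
    have e : p.rTensor H (rightCoaction π a) = TensorProduct.map p p (Coalgebra.comul a) := by
      rw [rightCoaction_apply, ← LinearMap.comp_apply, LinearMap.rTensor_comp_lTensor]
    have e' : TensorProduct.map p p (Coalgebra.comul a) = Coalgebra.comul (R := ℂ) (π a) :=
      CoalgHomClass.map_comp_comul_apply π a
    rw [e, e', ha, map_zero]
  obtain ⟨z, hz⟩ := (rTensor_exact H p.exact_subtype_ker_map hπ _).1 h0
  rw [← slice_rightCoaction_antipode (π := π) hφ.apply_self a, ← hz]
  clear hz
  induction z with
  | zero => simp
  | add x y hx hy => simp only [map_add]; exact Submodule.add_mem _ hx hy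
  | tmul x y =>
    have hx : π x.1 = 0 := x.2
    exact slice_mem_augmentationIdeal hπ hφ hx y

end Kernel

/-! ### Simplicity of the components and uniqueness of the decomposition -/

section Simple

variable {A : Type u} [Ring A] [HopfAlgebra ℂ A] {H : Type v} [Ring H] [HopfAlgebra ℂ H]
variable {π : A →ₐc[ℂ] H}

/-- The antipode identity writes this multiple of `a` as `∑ hit_φ(a S(t₍₁₎)) t₍₂₎`, with
coefficients in `B` and `t₍₂₎ ∈ T`. -/
theorem smul_mem_of_isSubobject {φ : H →ₗ[ℂ] ℂ} (hφ : IsGroupLikeFunctional (1 : H) φ)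
    {T : Submodule ℂ A} (hT : IsSubobject π T) {t : A} (ht : t ∈ T) {g : H} {a : A}
    (ha : a ∈ weightSpace π g) : φ (g * π (HopfAlgebra.antipode ℂ t)) • a ∈ T := by
  rw [← hit_mul_antipode_of_mem_weightSpace φ ha]
  obtain ⟨z, hz⟩ := hT.2 t ht
  rw [← hz]
  clear hz
  induction z with
  | zero => simp
  | add x y hx hy => simp only [map_add]; exact Submodule.add_mem _ hx hy
  | tmul x y => exact hT.1 _ (hit_mem_base hφ _) _ y.2

/-- Here `t = t₍₁₎ ε(t₍₂₎)` with `t₍₂₎ ∈ T`, so `T` vanishes if `ε` vanishes on it. -/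
theorem exists_counit_ne_zero_of_isSubobject {T : Submodule ℂ A} (hT : IsSubobject π T)
    (hT0 : T ≠ ⊥) : ∃ t ∈ T, Coalgebra.counit (R := ℂ) t ≠ 0 := by
  by_contra! h
  refine hT0 ((Submodule.eq_bot_iff _).2 fun t ht => ?_)
  obtain ⟨z, hz⟩ := hT.2 t ht
  have h1 := Coalgebra.lTensor_counit_comul (R := ℂ) t
  have h2 : ∀ z : A ⊗[ℂ] T, Coalgebra.counit.lTensor A (T.subtype.lTensor A z) = 0 := by
    intro z
    induction z with
    | zero => simp
    | add x y hx hy => simp only [map_add, hx, hy, add_zero]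
    | tmul x y => simp [h y.1 y.2]
  rw [← hz, h2] at h1
  have := congrArg (TensorProduct.rid ℂ A) h1
  simpa using this.symm

theorem component_ne_bot (hH : IsCosemisimple H) (hπ : Function.Surjective π)
    (γ : GroupLike ℂ H) : component π γ ≠ ⊥ := by
  obtain ⟨a, ha, h1⟩ := exists_mem_weightSpace_counit_eq_one hH hπ γ
  intro h
  rw [component_eq_weightSpace] at h
  rw [h, Submodule.mem_bot] at ha
  simp [ha] at h1

theorem IsGroupLikeFunctional.apply_mul_inv {φ : H →ₗ[ℂ] ℂ}
    (hφ : IsGroupLikeFunctional (1 : H) φ) [DecidableEq (GroupLike ℂ H)] (γ δ : GroupLike ℂ H) :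
    φ (γ.val * (δ⁻¹).val) = if γ = δ then 1 else 0 := by
  rw [← GroupLike.val_mul]
  split_ifs with h
  · subst h; rw [mul_inv_cancel]; exact hφ.apply_self
  · refine hφ.apply_of_ne (GroupLike.isGroupLikeElem_val _) fun h' => h ?_
    have : γ * δ⁻¹ = 1 := GroupLike.val_injective h'
    exact mul_inv_eq_one.1 this

/-- Every non-zero sub-object of `P` contains a homogeneous component. -/
theorem exists_component_le (hH : IsCosemisimple H)
    (hcentral : ∀ γ : GroupLike ℂ H, γ.val ∈ Set.center H) {T : Submodule ℂ A}
    (hT : IsSubobject π T) (hT0 : T ≠ ⊥) (hTP : T ≤ Subalgebra.toSubmodule (Total π)) :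
    ∃ γ, component π γ ≤ T := by
  classical
  obtain ⟨φ, hφ, -⟩ := exists_isGroupLikeFunctional hH (IsGroupLikeElem.one (R := ℂ) (A := H))
  obtain ⟨t, ht, ht0⟩ := exists_counit_ne_zero_of_isSubobject hT hT0
  have htP := hTP ht
  rw [← iSup_component hH hcentral, Submodule.mem_iSup_iff_exists_finsupp] at htP
  obtain ⟨f, hf, hft⟩ := htP
  have hex : ∃ δ, Coalgebra.counit (R := ℂ) (f δ) ≠ 0 := by
    by_contra! h
    refine ht0 ?_
    rw [← hft, Finsupp.sum, map_sum]
    exact Finset.sum_eq_zero fun δ _ => h δ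
  obtain ⟨δ, hδ⟩ := hex
  -- `π(S(f γ)) = ε(f γ) γ⁻¹`, and `φ(δ γ⁻¹)` is `1` if `γ = δ` and `0` otherwise: only the degree
  -- `δ` part of `t` survives.
  have hval : φ (δ.val * π (HopfAlgebra.antipode ℂ t)) = Coalgebra.counit (R := ℂ) (f δ) := by
    have e : ∀ γ, φ (δ.val * π (HopfAlgebra.antipode ℂ (f γ))) =
        if δ = γ then Coalgebra.counit (R := ℂ) (f γ) else 0 := by
      intro γ
      have hγ := hf γ
      rw [component_eq_weightSpace] at hγ
      rw [map_antipode_of_mem_weightSpace hγ, mul_smul_comm, map_smul, hφ.apply_mul_inv]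
      simp
    rw [← hft, Finsupp.sum]
    simp only [map_sum, Finset.mul_sum, e]
    rw [Finset.sum_ite_eq]
    split_ifs with h
    · rfl
    · rw [Finsupp.notMem_support_iff.1 h, map_zero]
  refine ⟨δ, fun a ha => ?_⟩
  rw [component_eq_weightSpace] at ha
  have := smul_mem_of_isSubobject hφ hT ht ha
  rw [hval] at this
  exact (T.smul_mem_iff hδ).1 this

/-- A nonzero sub-object of `E_γ` contains some `E_δ`, and independence of the components forces `δ
= γ`. -/
theorem isSimpleSubobject_component (hH : IsCosemisimple H)
    (hcentral : ∀ γ : GroupLike ℂ H, γ.val ∈ Set.center H) (hπ : Function.Surjective π)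
    (γ : GroupLike ℂ H) : IsSimpleSubobject π (component π γ) := by
  refine ⟨isSubobject_component π γ, component_ne_bot hH hπ γ, fun T hTγ hT => ?_⟩
  refine or_iff_not_imp_left.2 fun hT0 => le_antisymm hTγ ?_
  obtain ⟨δ, hδ⟩ := exists_component_le hH hcentral hT hT0 (hTγ.trans inf_le_left)
  by_cases h : δ = γ
  · exact h ▸ hδ
  · have := (iSupIndep_component hH (π := π)).pairwiseDisjoint h
    exact absurd (this.eq_bot_of_le (hδ.trans hTγ)) (component_ne_bot hH hπ δ)

theorem isSimpleDecomposition_range_component (hH : IsCosemisimple H)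
    (hcentral : ∀ γ : GroupLike ℂ H, γ.val ∈ Set.center H) (hπ : Function.Surjective π) :
    IsSimpleDecomposition π (Set.range (component π)) := by
  refine ⟨?_, (iSupIndep_component hH).sSupIndep_range, ?_⟩
  · rintro _ ⟨γ, rfl⟩
    exact isSimpleSubobject_component hH hcentral hπ γ
  · rw [sSup_range, iSup_component hH hcentral]

theorem IsSimpleDecomposition.eq_range_component (hH : IsCosemisimple H)
    (hcentral : ∀ γ : GroupLike ℂ H, γ.val ∈ Set.center H) (hπ : Function.Surjective π)
    {𝒮 : Set (Submodule ℂ A)} (h𝒮 : IsSimpleDecomposition π 𝒮) :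
    𝒮 = Set.range (component π) := by
  have hsub : 𝒮 ⊆ Set.range (component π) := by
    intro S hS
    have hsimple := h𝒮.1 S hS
    obtain ⟨γ, hγ⟩ := exists_component_le hH hcentral hsimple.1 hsimple.2.1
      (h𝒮.2.2 ▸ le_sSup hS)
    exact ⟨γ, (hsimple.2.2 _ hγ (isSubobject_component π γ)).resolve_left
      (component_ne_bot hH hπ γ)⟩
  refine hsub.antisymm ?_
  rintro _ ⟨γ, rfl⟩
  by_contra hγ
  -- If `E_γ` is missing, the other components already span `P`, which contains `E_γ`; independence
  -- then gives `E_γ = 0`.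
  have hle : sSup 𝒮 ≤ ⨆ δ, ⨆ (_ : δ ≠ γ), component π δ := by
    refine sSup_le fun S hS => ?_
    obtain ⟨δ, rfl⟩ := hsub hS
    exact le_iSup₂_of_le δ (fun h => hγ (h ▸ hS)) le_rfl
  rw [h𝒮.2.2] at hle
  exact component_ne_bot hH hπ γ
    ((iSupIndep_component hH γ).eq_bot_of_le ((inf_le_left : component π γ ≤ _).trans hle))

end Simple

/-! ### Sub-objects of `A` under `⊗_B`; invertibility of the components -/

section Line

variable {A : Type u} [Ring A] [HopfAlgebra ℂ A] {H : Type v} [Ring H] [HopfAlgebra ℂ H]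
variable {π : A →ₐc[ℂ] H} {S : Submodule ℂ A} (hS : IsSubobject π S)

/-- The inclusion of a sub-object of `A`. -/
def ofSubobjectIncl : (ofSubobject S hS).carrier →ₗ[ℂ] A := S.subtype

theorem ofSubobjectIncl_injective : Function.Injective (ofSubobjectIncl hS) :=
  Subtype.val_injective

theorem ofSubobjectIncl_mem (x : (ofSubobject S hS).carrier) : ofSubobjectIncl hS x ∈ S :=
  Subtype.prop (p := fun y => y ∈ S) x

theorem ofSubobjectIncl_smul (b : Base π) (x : (ofSubobject S hS).carrier) :
    ofSubobjectIncl hS (b • x) = b.1 * ofSubobjectIncl hS x := rfl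

theorem lTensor_ofSubobjectIncl_coact (x : (ofSubobject S hS).carrier) :
    (ofSubobjectIncl hS).lTensor A ((ofSubobject S hS).coaction.coact x) =
      Coalgebra.comul (ofSubobjectIncl hS x) :=
  lTensor_restrictComul S.subtype Subtype.val_injective (fun s => hS.2 s.1 s.2) x

/-- The right `B`-action on a sub-object of `A` is multiplication in `A`. -/
theorem ofSubobjectIncl_rightAct (b : Base π) (x : (ofSubobject S hS).carrier) :
    ofSubobjectIncl hS ((ofSubobject S hS).rightAct b x) = ofSubobjectIncl hS x * b.1 := by
  have e : ∀ z : A ⊗[ℂ] (ofSubobject S hS).carrier, ofSubobjectIncl hS (adjAct π _ b z) =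
      LinearMap.mul' ℂ A ((adj.flip b.1).rTensor A ((ofSubobjectIncl hS).lTensor A z)) := by
    intro z
    induction z with
    | zero => simp
    | add x y hx hy => simp only [map_add, hx, hy]
    | tmul a x => simp [ofSubobjectIncl_smul]
  rw [RelHopfMod.rightAct_apply, e, lTensor_ofSubobjectIncl_coact, lift_adj_comul]

variable {T : Submodule ℂ A} (hT : IsSubobject π T)

/-- Multiplication `S ⊗ T → A` for sub-objects `S` and `T` of `A`. -/
def mulSubobject : (ofSubobject S hS).carrier ⊗[ℂ] (ofSubobject T hT).carrier →ₗ[ℂ] A :=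
  LinearMap.mul' ℂ A ∘ₗ TensorProduct.map (ofSubobjectIncl hS) (ofSubobjectIncl hT)

@[simp]
theorem mulSubobject_tmul (x : (ofSubobject S hS).carrier) (y : (ofSubobject T hT).carrier) :
    mulSubobject hS hT (x ⊗ₜ y) = ofSubobjectIncl hS x * ofSubobjectIncl hT y := rfl

theorem lTensor_mulSubobject_diagCoact
    (z : (ofSubobject S hS).carrier ⊗[ℂ] (ofSubobject T hT).carrier) :
    (mulSubobject hS hT).lTensor A (diagCoact _ _ z) =
      Coalgebra.comul (mulSubobject hS hT z) := by
  have e : ∀ (x : A ⊗[ℂ] (ofSubobject S hS).carrier) (y : A ⊗[ℂ] (ofSubobject T hT).carrier),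
      (mulSubobject hS hT).lTensor A (TensorProduct.map₂ (LinearMap.mul ℂ A)
        (TensorProduct.mk ℂ _ _) x y) =
      (ofSubobjectIncl hS).lTensor A x * (ofSubobjectIncl hT).lTensor A y := by
    intro x y
    induction x with
    | zero => simp
    | add x x' hx hx' => simp only [map_add, LinearMap.add_apply, add_mul, hx, hx']
    | tmul a s =>
      induction y with
      | zero => simp
      | add y y' hy hy' => simp only [map_add, mul_add, hy, hy']
      | tmul a' t => simp
  induction z with
  | zero => simp
  | add x y hx hy => simp only [map_add, hx, hy]
  | tmul x y =>
    rw [diagCoact_tmul, e, lTensor_ofSubobjectIncl_coact, lTensor_ofSubobjectIncl_coact,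
      mulSubobject_tmul, Bialgebra.comul_mul]

/-- Multiplication `S ⊗_B T → A` for sub-objects `S` and `T` of `A`. -/
def mulBalanced : BalancedTensor (ofSubobject S hS) (ofSubobject T hT) →ₗ[ℂ] A :=
  (balancingRelations _ _).liftQ (mulSubobject hS hT) (by
    refine Submodule.span_le.2 ?_
    rintro _ ⟨f, b, g, rfl⟩
    simp [ofSubobjectIncl_rightAct, ofSubobjectIncl_smul, mul_assoc])

theorem mulBalanced_mk (z : (ofSubobject S hS).carrier ⊗[ℂ] (ofSubobject T hT).carrier) :
    mulBalanced hS hT (Submodule.Quotient.mk z) = mulSubobject hS hT z := rfl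

theorem mulBalanced_smul (b : Base π) (z : BalancedTensor (ofSubobject S hS) (ofSubobject T hT)) :
    mulBalanced hS hT (b • z) = b.1 * mulBalanced hS hT z := by
  obtain ⟨z, rfl⟩ := Submodule.Quotient.mk_surjective _ z
  rw [smul_mk_balancedTensor, mulBalanced_mk, mulBalanced_mk]
  induction z with
  | zero => simp
  | add x y hx hy => simp only [map_add, mul_add, hx, hy]
  | tmul x y => simp [ofSubobjectIncl_smul, mul_assoc]

theorem exists_mulSubobject_eq {a : A} (ha : a ∈ S * T) : ∃ z, mulSubobject hS hT z = a := by
  induction ha using Submodule.mul_induction_on' with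
  | mem_mul_mem m hm n hn =>
    let x : (ofSubobject S hS).carrier := (⟨m, hm⟩ : S)
    let y : (ofSubobject T hT).carrier := (⟨n, hn⟩ : T)
    exact ⟨x ⊗ₜ y, rfl⟩
  | add x _ y _ hx hy =>
    obtain ⟨z, rfl⟩ := hx
    obtain ⟨z', rfl⟩ := hy
    exact ⟨z + z', map_add _ _ _⟩

/-- Sub-objects `S`, `T` of `A` with `1 ∈ S T ⊆ B` and `T S ⊆ B` satisfy `S ⊗_B T ≅ B`. -/
theorem isIso_tensorObject_unitObject (h1 : (1 : A) ∈ S * T)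
    (hST : ∀ s ∈ S, ∀ t ∈ T, s * t ∈ Base π) (hTS : ∀ t ∈ T, ∀ s ∈ S, t * s ∈ Base π) :
    (tensorObject (ofSubobject S hS) (ofSubobject T hT)).IsIso (unitObject π) := by
  obtain ⟨z, hz⟩ := exists_mulSubobject_eq hS hT h1
  let N := BalancedTensor (ofSubobject S hS) (ofSubobject T hT)
  have hmem : ∀ x : N, mulBalanced hS hT x ∈ Subalgebra.toSubmodule (Base π) := by
    intro x
    obtain ⟨x, rfl⟩ := Submodule.Quotient.mk_surjective _ x
    rw [mulBalanced_mk]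
    induction x with
    | zero => simp
    | add x y hx hy => rw [map_add]; exact Submodule.add_mem _ hx hy
    | tmul x y => exact hST _ (ofSubobjectIncl_mem hS x) _ (ofSubobjectIncl_mem hT y)
  -- With `z` of product `1`, the map `b ↦ b [z]` is the candidate inverse of multiplication.
  have hinv : ∀ x : N, (⟨mulBalanced hS hT x, hmem x⟩ : Base π) • (Submodule.Quotient.mk z : N) =
      x := by
    intro x
    obtain ⟨x, rfl⟩ := Submodule.Quotient.mk_surjective _ x
    induction x with
    | zero =>
      have : (⟨mulBalanced hS hT (Submodule.Quotient.mk 0), hmem _⟩ : Base π) = 0 :=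
        Subtype.ext (map_zero _)
      rw [this, zero_smul]; rfl
    | add x y hx hy =>
      have : (⟨mulBalanced hS hT (Submodule.Quotient.mk (x + y)), hmem _⟩ : Base π) =
          ⟨mulBalanced hS hT (Submodule.Quotient.mk x), hmem _⟩ +
          ⟨mulBalanced hS hT (Submodule.Quotient.mk y), hmem _⟩ :=
        Subtype.ext (map_add (mulBalanced hS hT) (Submodule.Quotient.mk x)
          (Submodule.Quotient.mk y))
      rw [this, add_smul, hx, hy]; rfl
    | tmul f g =>
      -- Since `g s ∈ B` for `s ∈ S`, it crosses the tensor sign: `(f g) s ⊗ t = f (g s) ⊗ t = f ⊗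
      -- (g s) t`. Summed over `z`, the right factor becomes `g · 1 = g`.
      let R : (ofSubobject S hS).carrier →ₗ[ℂ] Base π :=
        LinearMap.codRestrict (Subalgebra.toSubmodule (Base π))
          (LinearMap.mulLeft ℂ (ofSubobjectIncl hT g) ∘ₗ ofSubobjectIncl hS)
          (fun x => hTS _ (ofSubobjectIncl_mem hT g) _ (ofSubobjectIncl_mem hS x))
      have hR : ∀ x, (R x).1 = ofSubobjectIncl hT g * ofSubobjectIncl hS x := fun _ => rfl
      let Q : (ofSubobject S hS).carrier ⊗[ℂ] (ofSubobject T hT).carrier →ₗ[ℂ]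
          (ofSubobject T hT).carrier :=
        TensorProduct.lift (actBase π (ofSubobject T hT).carrier ∘ₗ R)
      have hQ : ∀ z, ofSubobjectIncl hT (Q z) = ofSubobjectIncl hT g * mulSubobject hS hT z := by
        intro z
        induction z with
        | zero => simp
        | add x y hx hy => simp only [map_add, mul_add, hx, hy]
        | tmul x y => simp [Q, ofSubobjectIncl_smul, hR, mul_assoc]
      have hQz : Q z = g := by
        apply ofSubobjectIncl_injective hT
        rw [hQ, hz, mul_one]
      have key : ∀ z, (⟨mulBalanced hS hT (Submodule.Quotient.mk (f ⊗ₜ g)), hmem _⟩ : Base π) •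
          (Submodule.Quotient.mk z : N) = Submodule.Quotient.mk (f ⊗ₜ Q z) := by
        intro z
        rw [smul_mk_balancedTensor]
        induction z with
        | zero => simp
        | add x y hx hy => simp only [map_add, tmul_add, Submodule.Quotient.mk_add, hx, hy]
        | tmul x y =>
          have hx : (⟨mulBalanced hS hT (Submodule.Quotient.mk (f ⊗ₜ g)), hmem _⟩ : Base π) • x =
              (ofSubobject S hS).rightAct (R x) f := by
            apply ofSubobjectIncl_injective hS
            rw [ofSubobjectIncl_smul, ofSubobjectIncl_rightAct, hR]
            exact mul_assoc _ _ _
          rw [LinearMap.rTensor_tmul, actBase_apply, hx, Submodule.Quotient.eq]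
          exact Submodule.subset_span ⟨f, R x, y, rfl⟩
      rw [key, hQz]
  let m : N →ₗ[ℂ] (unitObject π).carrier :=
    LinearMap.codRestrict (Subalgebra.toSubmodule (Base π)) (mulBalanced hS hT) hmem
  have hm : ∀ x, ofSubobjectIncl isSubobject_base (m x) = mulBalanced hS hT x := fun _ => rfl
  have hbij : Function.Bijective m := by
    constructor
    · intro x y hxy
      have h : mulBalanced hS hT x = mulBalanced hS hT y := congrArg Subtype.val hxy
      rw [← hinv x, ← hinv y]
      congr 2
    · intro b
      let b' : Base π := b
      refine ⟨b' • Submodule.Quotient.mk z, ofSubobjectIncl_injective isSubobject_base ?_⟩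
      rw [hm, mulBalanced_smul, mulBalanced_mk, hz, mul_one]
      rfl
  refine ⟨LinearEquiv.ofBijective m hbij, fun b x => ?_, fun x => ?_⟩
  · apply ofSubobjectIncl_injective isSubobject_base
    exact mulBalanced_smul hS hT b x
  · apply Module.Flat.lTensor_preserves_injective_linearMap (M := A)
      (ofSubobjectIncl isSubobject_base) (ofSubobjectIncl_injective isSubobject_base)
    refine (lTensor_ofSubobjectIncl_coact isSubobject_base _).trans ?_
    have e : ∀ y : A ⊗[ℂ] N, (ofSubobjectIncl isSubobject_base).lTensor A (m.lTensor A y) =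
        (mulBalanced hS hT).lTensor A y := fun y =>
      (LinearMap.lTensor_comp_apply A (ofSubobjectIncl isSubobject_base) m y).symm
    refine Eq.trans ?_ (e _).symm
    obtain ⟨x, rfl⟩ := Submodule.Quotient.mk_surjective _ x
    refine (lTensor_mulSubobject_diagCoact hS hT x).symm.trans ?_
    refine Eq.trans ?_ (congrArg _ (balancedCoact_mk _ _ x)).symm
    exact LinearMap.lTensor_comp_apply A (mulBalanced hS hT) (balancingRelations _ _).mkQ _

theorem isRelativeLineModule_component (hH : IsCosemisimple H) (hπ : Function.Surjective π)
    (γ : GroupLike ℂ H) : IsRelativeLineModule (componentObject π γ) := by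
  have key : ∀ γ δ : GroupLike ℂ H, γ * δ = 1 →
      (tensorObject (componentObject π γ) (componentObject π δ)).IsIso (unitObject π) := by
    intro γ δ h
    have h' : δ * γ = 1 := mul_eq_one_comm.1 h
    refine isIso_tensorObject_unitObject _ _ ?_ ?_ ?_
    · rw [component_mul_component hH hπ, h, component_one]
      exact (Base π).one_mem
    · intro s hs t ht
      have := Submodule.mul_mem_mul hs ht
      rwa [component_mul_component hH hπ, h, component_one] at this
    · intro t ht s hs
      have := Submodule.mul_mem_mul ht hs
      rwa [component_mul_component hH hπ, h', component_one] at this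
  exact ⟨componentObject π γ⁻¹, key _ _ (mul_inv_cancel γ), key _ _ (inv_mul_cancel γ)⟩

end Line

/-! ### The comodule `Φ(E_γ)` -/

section PhiComponent

variable {A : Type u} [Ring A] [HopfAlgebra ℂ A] {H : Type v} [Ring H] [HopfAlgebra ℂ H]
variable {π : A →ₐc[ℂ] H}

/-- `E_γ ∩ ker ε = B⁺ E_γ`. -/
theorem mem_augmentationSubmodule_component_iff (hH : IsCosemisimple H)
    (hπ : Function.Surjective π) (γ : GroupLike ℂ H) (x : (componentObject π γ).carrier) :
    x ∈ augmentationSubmodule (componentObject π γ) ↔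
      π (ofSubobjectIncl (isSubobject_component π γ) x) = 0 := by
  let i := ofSubobjectIncl (isSubobject_component π γ)
  constructor
  · intro hx
    have hle : augmentationSubmodule (componentObject π γ) ≤
        LinearMap.ker ((π : A →ₐ[ℂ] H).toLinearMap ∘ₗ i) := by
      refine Submodule.span_le.2 ?_
      rintro _ ⟨b, f, hb, rfl⟩
      change π (b.1 * i f) = 0
      rw [map_mul, map_base, hb, map_zero, zero_mul]
    exact hle hx
  · intro hx
    have hmem : ∀ x, i x ∈ component π γ := ofSubobjectIncl_mem _
    -- Writing `1 = ∑ mᵢ nᵢ` with `mᵢ ∈ E_{γ⁻¹}` and `nᵢ ∈ E_γ` gives `x = ∑ (x mᵢ) nᵢ`, where `x mᵢ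
    -- ∈ B` has counit `ε(x) ε(mᵢ) = 0`.
    have h1 : (1 : A) ∈ component π γ⁻¹ * component π γ := by
      rw [component_mul_component hH hπ, inv_mul_cancel, component_one]
      exact (Base π).one_mem
    have key : ∀ a ∈ component π γ⁻¹ * component π γ, ∃ y ∈
        augmentationSubmodule (componentObject π γ), i y = i x * a := by
      intro a ha
      induction ha using Submodule.mul_induction_on' with
      | mem_mul_mem m hm n hn =>
        have hb : i x * m ∈ Base π := by
          have := Submodule.mul_mem_mul (hmem x) hm
          rwa [component_mul_component hH hπ, mul_inv_cancel, component_one] at this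
        have hε : Coalgebra.counit (R := ℂ) (i x) = 0 := by
          rw [← CoalgHomClass.counit_comp_apply π, hx, map_zero]
        refine ⟨(⟨i x * m, hb⟩ : Base π) • (show (componentObject π γ).carrier from
          (⟨n, hn⟩ : component π γ)), Submodule.subset_span ⟨_, _, ?_, rfl⟩, ?_⟩
        · rw [Bialgebra.counit_mul, hε, zero_mul]
        · exact mul_assoc _ _ _
      | add a _ b _ ha hb =>
        obtain ⟨y, hy, hya⟩ := ha
        obtain ⟨z, hz, hzb⟩ := hb
        exact ⟨y + z, Submodule.add_mem _ hy hz, (map_add i y z).trans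
          ((congrArg₂ (· + ·) hya hzb).trans (mul_add _ _ _).symm)⟩
    obtain ⟨y, hy, hyx⟩ := key 1 h1
    rw [mul_one] at hyx
    exact ofSubobjectIncl_injective _ hyx ▸ hy

theorem exists_phi_component_equiv (hH : IsCosemisimple H) (hπ : Function.Surjective π)
    (γ : GroupLike ℂ H) :
    ∃ e : Phi (componentObject π γ) ≃ₗ[ℂ] Submodule.span ℂ {γ.val},
      (∀ x : component π γ, (e (Submodule.Quotient.mk x) : H) = π x.1) ∧
      ∀ y, Coalgebra.comul (R := ℂ) (e y : H) =
        ((Submodule.span ℂ {γ.val}).subtype ∘ₗ e.toLinearMap).lTensor H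
          ((phiCoaction (componentObject π γ)).coact y) := by
  let i : (componentObject π γ).carrier →ₗ[ℂ] A := ofSubobjectIncl (isSubobject_component π γ)
  have hmap := map_component hH hπ γ
  let f : (componentObject π γ).carrier →ₗ[ℂ] Submodule.span ℂ {γ.val} :=
    LinearMap.codRestrict _ ((π : A →ₐ[ℂ] H).toLinearMap ∘ₗ i) (fun x => by
      rw [← hmap]; exact ⟨_, ofSubobjectIncl_mem _ x, rfl⟩)
  have hf : ∀ x, (f x : H) = π (i x) := fun _ => rfl
  have hsurj : Function.Surjective f := by
    rintro ⟨y, hy⟩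
    rw [← hmap] at hy
    obtain ⟨a, ha, rfl⟩ := hy
    exact ⟨(⟨a, ha⟩ : component π γ), rfl⟩
  have hker : augmentationSubmodule (componentObject π γ) = LinearMap.ker f := by
    ext x
    rw [mem_augmentationSubmodule_component_iff hH hπ, LinearMap.mem_ker, ← Subtype.val_inj, hf]
    rfl
  let e := (Submodule.quotEquivOfEq _ _ hker).trans (f.quotKerEquivOfSurjective hsurj)
  have he : ∀ x, e (Submodule.Quotient.mk x) = f x := fun _ => rfl
  refine ⟨e, fun x => congrArg Subtype.val (he x), fun y => ?_⟩
  obtain ⟨x, rfl⟩ := Submodule.Quotient.mk_surjective _ y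
  have hc : Coalgebra.comul (R := ℂ) (π (i x)) = TensorProduct.map (π : A →ₐ[ℂ] H).toLinearMap
      (π : A →ₐ[ℂ] H).toLinearMap (Coalgebra.comul (i x)) :=
    (CoalgHomClass.map_comp_comul_apply π _).symm
  have e1 : ∀ z : A ⊗[ℂ] (componentObject π γ).carrier,
      TensorProduct.map (π : A →ₐ[ℂ] H).toLinearMap (π : A →ₐ[ℂ] H).toLinearMap (i.lTensor A z) =
      ((Submodule.span ℂ {γ.val}).subtype ∘ₗ e.toLinearMap).lTensor H
        (TensorProduct.map (π : A →ₐ[ℂ] H).toLinearMap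
          (augmentationSubmodule (componentObject π γ)).mkQ z) := by
    intro z
    induction z with
    | zero => simp only [map_zero]
    | add x y hx hy => simp only [map_add, hx, hy]
    | tmul a x => rfl
  rw [he, hf, hc]
  refine Eq.trans ?_ (e1 _)
  exact congrArg _ (lTensor_ofSubobjectIncl_coact (isSubobject_component π γ) x).symm

end PhiComponent

/-! ### Recovering a relative Hopf module from `Φ` -/

section Takeuchi

variable {A : Type u} [Ring A] [HopfAlgebra ℂ A] {H : Type v} [Ring H] [HopfAlgebra ℂ H]
variable {π : A →ₐc[ℂ] H}

/-- The map `a ⊗ m ↦ E(a S(m₍₋₁₎)) m₍₀₎`, where `E : A → B` is the projection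
`a ↦ a₍₁₎ φ(π(a₍₂₎))`. -/
def averaging (F : RelHopfMod.{u, v, w} π) {φ : H →ₗ[ℂ] ℂ}
    (hφ : IsGroupLikeFunctional (1 : H) φ) (a : A) : F.carrier →ₗ[ℂ] F.carrier :=
  TensorProduct.lift (actBase π F.carrier ∘ₗ
    LinearMap.codRestrict (Subalgebra.toSubmodule (Base π))
      (hit π φ ∘ₗ LinearMap.mulLeft ℂ a ∘ₗ HopfAlgebra.antipode ℂ)
      (fun _ => hit_mem_base hφ _)) ∘ₗ F.coaction.coact

variable (F : RelHopfMod.{u, v, w} π) {φ : H →ₗ[ℂ] ℂ} (hφ : IsGroupLikeFunctional (1 : H) φ)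

/-- `E` is right `B`-linear and `b₍₂₎ ∈ B`, so the `b`-terms collapse: `E(a S(m₍₋₁₎) S(b₍₁₎)) b₍₂₎ =
E(a S(m₍₋₁₎) S(b₍₁₎) b₍₂₎) = ε(b) E(a S(m₍₋₁₎))`. Hence averaging factors through `Φ(F)`. -/
theorem averaging_smul (a : A) (b : Base π) (m : F.carrier) :
    averaging F hφ a (b • m) = Coalgebra.counit (R := ℂ) b.1 • averaging F hφ a m := by
  let E : A → A →ₗ[ℂ] Base π := fun a =>
    LinearMap.codRestrict (Subalgebra.toSubmodule (Base π))
      (hit π φ ∘ₗ LinearMap.mulLeft ℂ a ∘ₗ HopfAlgebra.antipode ℂ) (fun _ => hit_mem_base hφ _)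
  have hE : ∀ a x, (E a x).1 = hit π φ (a * HopfAlgebra.antipode ℂ x) := fun _ _ => rfl
  have hav : ∀ m, averaging F hφ a m =
      TensorProduct.lift (actBase π F.carrier ∘ₗ E a) (F.coaction.coact m) := fun _ => rfl
  rw [hav, hav, F.coact_smul]
  generalize F.coaction.coact m = y
  induction y with
  | zero => simp only [map_zero, smul_zero]
  | add y y' hy hy' => simp only [map_add, smul_add, hy, hy']
  | tmul x m =>
    have e : ∀ t : A ⊗[ℂ] Base π, TensorProduct.lift (actBase π F.carrier ∘ₗ E a)
        (TensorProduct.map₂ (LinearMap.mul ℂ A) (actBase π F.carrier) t (x ⊗ₜ m)) =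
        (LinearMap.mul' ℂ (Base π) ((E (a * HopfAlgebra.antipode ℂ x)).rTensor (Base π) t)) •
          m := by
      intro t
      induction t with
      | zero => simp
      | add t t' ht ht' => simp only [map_add, LinearMap.add_apply, add_smul, ht, ht']
      | tmul c b =>
        have : E a (c * x) = E (a * HopfAlgebra.antipode ℂ x) c := by
          apply Subtype.ext
          rw [hE, hE, HopfAlgebra.antipode_mul_antidistrib, mul_assoc]
        simp [this, mul_smul]
    have e' : ∀ t : A ⊗[ℂ] Base π,
        (LinearMap.mul' ℂ (Base π) ((E (a * HopfAlgebra.antipode ℂ x)).rTensor (Base π) t)).1 =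
        hit π φ (a * HopfAlgebra.antipode ℂ x * LinearMap.mul' ℂ A
          ((HopfAlgebra.antipode ℂ).rTensor A ((Base π).val.toLinearMap.lTensor A t))) := by
      intro t
      induction t with
      | zero => simp
      | add t t' ht ht' => simp only [map_add, mul_add, Subalgebra.coe_add, ht, ht']
      | tmul c b =>
        simp only [LinearMap.rTensor_tmul, LinearMap.lTensor_tmul, LinearMap.mul'_apply,
          Subalgebra.coe_mul, hE, ← mul_assoc, AlgHom.toLinearMap_apply, Subalgebra.coe_val]
        exact (hit_mul_base φ _ b.2).symm
    have h : LinearMap.mul' ℂ (Base π) ((E (a * HopfAlgebra.antipode ℂ x)).rTensor (Base π)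
        ((baseCoaction π).coact b)) = Coalgebra.counit (R := ℂ) b.1 • E a x := by
      apply Subtype.ext
      rw [e', lTensor_baseCoaction, HopfAlgebra.mul_antipode_rTensor_comul_apply,
        Algebra.algebraMap_eq_smul_one, mul_smul_comm, mul_one, map_smul]
      rfl
    rw [e, h]
    simp

theorem averaging_of_mem_augmentationSubmodule (a : A) {m : F.carrier}
    (hm : m ∈ augmentationSubmodule F) : averaging F hφ a m = 0 := by
  have hle : augmentationSubmodule F ≤ LinearMap.ker (averaging F hφ a) := by
    refine Submodule.span_le.2 ?_
    rintro _ ⟨b, f, hb, rfl⟩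
    rw [SetLike.mem_coe, LinearMap.mem_ker, averaging_smul, hb, zero_smul]
  exact hle hm

/-- `E(m₍₋₂₎ S(m₍₋₁₎)) m₍₀₎ = m`. -/
theorem lift_averaging_coact (L : A →ₗ[ℂ] F.carrier →ₗ[ℂ] F.carrier)
    (hL : ∀ a m, L a m = averaging F hφ a m) (m : F.carrier) :
    TensorProduct.lift L (F.coaction.coact m) = m := by
  let E : A →ₗ[ℂ] Base π := LinearMap.codRestrict (Subalgebra.toSubmodule (Base π)) (hit π φ)
    (fun _ => hit_mem_base hφ _)
  let ν : A ⊗[ℂ] A →ₗ[ℂ] A := LinearMap.mul' ℂ A ∘ₗ (HopfAlgebra.antipode ℂ).lTensor A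
  let Q : A ⊗[ℂ] F.carrier →ₗ[ℂ] F.carrier := TensorProduct.lift (actBase π F.carrier ∘ₗ E)
  -- Regrouping by coassociativity makes `m₍₋₂₎ S(m₍₋₁₎)` collapse to a counit; then `E(1) = 1`
  -- finishes.
  have h1 : ∀ z : A ⊗[ℂ] F.carrier, TensorProduct.lift L z =
      Q (ν.rTensor F.carrier ((TensorProduct.assoc ℂ A A F.carrier).symm
        (F.coaction.coact.lTensor A z))) := by
    intro z
    induction z with
    | zero => simp
    | add x y hx hy => simp only [map_add, hx, hy]
    | tmul a m =>
      rw [TensorProduct.lift.tmul, hL, LinearMap.lTensor_tmul, averaging, LinearMap.comp_apply]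
      generalize F.coaction.coact m = t
      induction t with
      | zero => simp
      | add x y hx hy => simp only [map_add, tmul_add, hx, hy]
      | tmul x m => rfl
  have h2 : ν ∘ₗ Coalgebra.comul = Algebra.linearMap ℂ A ∘ₗ Coalgebra.counit :=
    HopfAlgebra.mul_antipode_lTensor_comul
  have hE1 : E 1 = 1 := by
    apply Subtype.ext
    change hit π φ 1 = 1
    rw [hit_apply, map_one, Algebra.TensorProduct.one_def, slice_tmul, hφ.apply_self, one_smul]
  have h3 : ∀ z : A ⊗[ℂ] F.carrier,
      Q ((Algebra.linearMap ℂ A ∘ₗ Coalgebra.counit).rTensor F.carrier z) =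
      TensorProduct.lid ℂ F.carrier (Coalgebra.counit.rTensor F.carrier z) := by
    intro z
    induction z with
    | zero => simp
    | add x y hx hy => simp only [map_add, hx, hy]
    | tmul a m => simp [Q, Algebra.algebraMap_eq_smul_one, hE1]
  rw [h1, ← F.coaction.coassoc, LinearEquiv.symm_apply_apply, ← LinearMap.rTensor_comp_apply,
    h2, h3, F.coaction.counit_coact]

/-- The map `a ⊗ m ↦ E(a S(m₍₋₁₎)) m₍₀₎` as a bilinear map. -/
theorem exists_averaging_bilinear : ∃ L : A →ₗ[ℂ] F.carrier →ₗ[ℂ] F.carrier,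
    ∀ a m, L a m = averaging F hφ a m := by
  refine ⟨LinearMap.mk₂ ℂ (fun a m => averaging F hφ a m) ?_ ?_ ?_ ?_, fun _ _ => rfl⟩
  · intro a a' m
    simp only [averaging, LinearMap.comp_apply]
    generalize F.coaction.coact m = t
    induction t with
    | zero => simp
    | add x y hx hy => simp only [map_add, hx, hy]; abel
    | tmul x m =>
      simp only [TensorProduct.lift.tmul, LinearMap.comp_apply, actBase_apply, ← add_smul]
      congr 1
      apply Subtype.ext
      change hit π φ ((a + a') * HopfAlgebra.antipode ℂ x) = _
      rw [add_mul, map_add]; rfl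
  · intro c a m
    simp only [averaging, LinearMap.comp_apply]
    generalize F.coaction.coact m = t
    induction t with
    | zero => simp
    | add x y hx hy => simp only [map_add, smul_add, hx, hy]
    | tmul x m =>
      simp only [TensorProduct.lift.tmul, LinearMap.comp_apply, actBase_apply, ← smul_assoc]
      congr 1
      apply Subtype.ext
      change hit π φ ((c • a) * HopfAlgebra.antipode ℂ x) = _
      rw [smul_mul_assoc, map_smul]; rfl
  · intro a m m'; exact map_add _ _ _
  · intro c a m; exact map_smul _ _ _

/-- If `Φ(F) = 0`, then `F = 0`. -/
theorem eq_zero_of_augmentationSubmodule_eq_top (hH : IsCosemisimple H)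
    (h : augmentationSubmodule F = ⊤) (m : F.carrier) : m = 0 := by
  obtain ⟨φ, hφ, -⟩ := exists_isGroupLikeFunctional hH (IsGroupLikeElem.one (R := ℂ) (A := H))
  obtain ⟨L, hL⟩ := exists_averaging_bilinear F hφ
  -- Averaging kills `B⁺ F`, here all of `F`, yet composed with the coaction it reproduces every
  -- `m`.
  have hL0 : TensorProduct.lift L = 0 := by
    ext a m
    simp only [TensorProduct.AlgebraTensorModule.curry_apply, TensorProduct.curry_apply,
      LinearMap.restrictScalars_self, TensorProduct.lift.tmul, hL]
    exact averaging_of_mem_augmentationSubmodule F hφ a (h ▸ Submodule.mem_top)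
  have := lift_averaging_coact F hφ L hL m
  rw [hL0] at this
  exact this.symm

end Takeuchi

/-! ### Classification of relative line modules -/

section LineFunctional

variable {A : Type u} [Ring A] [HopfAlgebra ℂ A] {H : Type v} [Ring H] [HopfAlgebra ℂ H]
variable {π : A →ₐc[ℂ] H} (F : RelHopfMod.{u, v, w} π)

/-- The map `m ↦ m₍₋₁₎ f(m₍₀₎)` associated to a functional `f`. -/
def matrixCoeff (f : F.carrier →ₗ[ℂ] ℂ) : F.carrier →ₗ[ℂ] A :=
  (TensorProduct.rid ℂ A).toLinearMap ∘ₗ f.lTensor A ∘ₗ F.coaction.coact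

variable {F} {f : F.carrier →ₗ[ℂ] ℂ}

theorem comul_matrixCoeff (m : F.carrier) :
    Coalgebra.comul (matrixCoeff F f m) = (matrixCoeff F f).lTensor A (F.coaction.coact m) := by
  let R : A ⊗[ℂ] F.carrier →ₗ[ℂ] A := (TensorProduct.rid ℂ A).toLinearMap ∘ₗ f.lTensor A
  have h1 : ∀ z : A ⊗[ℂ] F.carrier, Coalgebra.comul (R z) =
      R.lTensor A (TensorProduct.assoc ℂ A A F.carrier (Coalgebra.comul.rTensor F.carrier z)) := by
    intro z
    induction z with
    | zero => simp
    | add x y hx hy => simp only [map_add, hx, hy]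
    | tmul a m =>
      rw [LinearMap.rTensor_tmul]
      have : R (a ⊗ₜ m) = f m • a := by simp [R]
      rw [this, map_smul]
      generalize Coalgebra.comul (R := ℂ) a = t
      induction t with
      | zero => simp
      | add x y hx hy => simp only [map_add, add_tmul, smul_add, hx, hy]
      | tmul x y => simp [R]
  have h2 : matrixCoeff F f = R ∘ₗ F.coaction.coact := rfl
  rw [h2, LinearMap.comp_apply, h1, F.coaction.coassoc, ← LinearMap.lTensor_comp_apply]

/-- Since `f` sees `B` only through `ε`, the factor `Δ(b)` contributes `b₍₁₎ ε(b₍₂₎) = b`. -/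
theorem matrixCoeff_smul (hf : ∀ (b : Base π) m, f (b • m) = Coalgebra.counit (R := ℂ) b.1 • f m)
    (b : Base π) (m : F.carrier) :
    matrixCoeff F f (b • m) = b.1 * matrixCoeff F f m := by
  rw [matrixCoeff, LinearMap.comp_apply, LinearMap.comp_apply, LinearMap.comp_apply,
    LinearMap.comp_apply, F.coact_smul]
  generalize F.coaction.coact m = y
  induction y with
  | zero => simp
  | add x y hx hy => simp only [map_add, mul_add, hx, hy]
  | tmul x m =>
    have e : ∀ t : A ⊗[ℂ] Base π, TensorProduct.rid ℂ A (f.lTensor A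
        (TensorProduct.map₂ (LinearMap.mul ℂ A) (actBase π F.carrier) t (x ⊗ₜ m))) =
        TensorProduct.rid ℂ A (Coalgebra.counit.lTensor A
          ((Base π).val.toLinearMap.lTensor A t)) * (f m • x) := by
      intro t
      induction t with
      | zero => simp
      | add t t' ht ht' => simp only [map_add, LinearMap.add_apply, add_mul, ht, ht']
      | tmul c b => simp [hf, smul_smul, mul_comm]
    have := e ((baseCoaction π).coact b)
    rw [lTensor_baseCoaction, Coalgebra.lTensor_counit_comul] at this
    simpa using this

theorem matrixCoeff_mem_weightSpace {g : H} (hg : ∀ m, π (matrixCoeff F f m) = f m • g)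
    (m : F.carrier) : matrixCoeff F f m ∈ weightSpace π g := by
  have h : (π : A →ₐ[ℂ] H).toLinearMap ∘ₗ matrixCoeff F f = f.smulRight g := by
    ext m; exact hg m
  rw [mem_weightSpace, rightCoaction_apply, comul_matrixCoeff, ← LinearMap.lTensor_comp_apply, h]
  have e : ∀ z : A ⊗[ℂ] F.carrier, (f.smulRight g).lTensor A z =
      TensorProduct.rid ℂ A (f.lTensor A z) ⊗ₜ g := by
    intro z
    induction z with
    | zero => simp
    | add x y hx hy => simp only [map_add, add_tmul, hx, hy]
    | tmul a m => simp [TensorProduct.smul_tmul]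
  exact e _

/-- A relative Hopf module `F` with `Φ(F) ≅ ℂ γ` is isomorphic to `E_γ`. -/
theorem isIso_componentObject_of_functional (hH : IsCosemisimple H) (γ : GroupLike ℂ H)
    (hker : LinearMap.ker f = augmentationSubmodule F) (hf0 : f ≠ 0)
    (hγ : ∀ m, π (matrixCoeff F f m) = f m • γ.val) : F.IsIso (componentObject π γ) := by
  obtain ⟨φ, hφ, -⟩ := exists_isGroupLikeFunctional hH (IsGroupLikeElem.one (R := ℂ) (A := H))
  obtain ⟨L, hL⟩ := exists_averaging_bilinear F hφ
  obtain ⟨m₀, hm₀⟩ : ∃ m, f m = 1 := by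
    obtain ⟨m, hm⟩ := DFunLike.ne_iff.1 hf0
    exact ⟨(f m)⁻¹ • m, by rw [map_smul]; exact inv_mul_cancel₀ hm⟩
  have hf : ∀ (b : Base π) m, f (b • m) = Coalgebra.counit (R := ℂ) b.1 • f m := by
    intro b m
    have : b • m - Coalgebra.counit (R := ℂ) b.1 • m ∈ LinearMap.ker f := by
      rw [hker, ← Submodule.Quotient.mk_eq_zero, Submodule.Quotient.mk_sub, mk_base_smul,
        Submodule.Quotient.mk_smul, sub_self]
    rwa [LinearMap.mem_ker, map_sub, sub_eq_zero,
      map_smul f (Coalgebra.counit (R := ℂ) b.1) m] at this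
  let θ := matrixCoeff F f
  have hθ : ∀ m, θ m ∈ component π γ := fun m => by
    rw [component_eq_weightSpace]; exact matrixCoeff_mem_weightSpace hγ m
  have hinj : Function.Injective θ := by
    rw [injective_iff_map_eq_zero]
    intro m hm
    -- Modulo `B⁺ F = ker f` each `m` is `f(m) m₀`, so the reproducing formula becomes `m = L(θ(m))
    -- m₀`, a left inverse of `θ`.
    have e : ∀ z : A ⊗[ℂ] F.carrier, TensorProduct.lift L z =
        L (TensorProduct.rid ℂ A (f.lTensor A z)) m₀ := by
      intro z
      induction z with
      | zero => simp
      | add x y hx hy => simp only [map_add, LinearMap.add_apply, hx, hy]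
      | tmul a m =>
        have hk : m - f m • m₀ ∈ augmentationSubmodule F := by
          rw [← hker, LinearMap.mem_ker, map_sub, map_smul, hm₀, smul_eq_mul, mul_one, sub_self]
        have := averaging_of_mem_augmentationSubmodule F hφ a hk
        rw [← hL, map_sub, map_smul, sub_eq_zero] at this
        simpa using this
    rw [← lift_averaging_coact F hφ L hL m, e]
    change L (θ m) m₀ = 0
    rw [hm, map_zero, LinearMap.zero_apply]
  have hsurj : ∀ a ∈ component π γ, ∃ m, θ m = a := by
    intro a ha
    rw [component_eq_weightSpace] at ha
    -- This is the inverse just found. Applying `θ` gives the antipode identity for `t = θ(m₀)`, and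
    -- `π(t) = γ` makes the scalar `φ(γ γ⁻¹) = 1`.
    refine ⟨averaging F hφ a m₀, ?_⟩
    have e : ∀ z : A ⊗[ℂ] F.carrier, θ (TensorProduct.lift (actBase π F.carrier ∘ₗ
        LinearMap.codRestrict (Subalgebra.toSubmodule (Base π))
          (hit π φ ∘ₗ LinearMap.mulLeft ℂ a ∘ₗ HopfAlgebra.antipode ℂ)
          (fun _ => hit_mem_base hφ _)) z) =
        LinearMap.mul' ℂ A ((hit π φ ∘ₗ LinearMap.mulLeft ℂ a ∘ₗ
          HopfAlgebra.antipode ℂ).rTensor A (θ.lTensor A z)) := by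
      intro z
      induction z with
      | zero => simp
      | add x y hx hy => simp only [map_add, hx, hy]
      | tmul x m => exact matrixCoeff_smul hf _ _
    have hv : φ (γ.val * (γ⁻¹).val) = 1 := by
      rw [← GroupLike.val_mul, mul_inv_cancel]; exact hφ.apply_self
    refine (e _).trans ?_
    rw [← comul_matrixCoeff, hit_mul_antipode_of_mem_weightSpace φ ha, map_antipode_apply, hγ,
      hm₀, one_smul, ← GroupLike.val_inv, hv, one_smul]
  let Θ : F.carrier →ₗ[ℂ] (componentObject π γ).carrier :=
    LinearMap.codRestrict (component π γ) θ hθ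
  have hbij : Function.Bijective Θ := by
    refine ⟨fun x y h => hinj (congrArg Subtype.val h), fun y => ?_⟩
    obtain ⟨m, hm⟩ := hsurj _ (ofSubobjectIncl_mem (isSubobject_component π γ) y)
    exact ⟨m, ofSubobjectIncl_injective (isSubobject_component π γ) hm⟩
  refine ⟨LinearEquiv.ofBijective Θ hbij, fun b m => ?_, fun m => ?_⟩
  · exact ofSubobjectIncl_injective (isSubobject_component π γ) (matrixCoeff_smul hf b m)
  · apply Module.Flat.lTensor_preserves_injective_linearMap (M := A)
      (ofSubobjectIncl (isSubobject_component π γ)) (ofSubobjectIncl_injective _)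
    refine (lTensor_ofSubobjectIncl_coact (isSubobject_component π γ) _).trans ?_
    refine (comul_matrixCoeff (F := F) (f := f) m).trans ?_
    exact LinearMap.lTensor_comp_apply A (ofSubobjectIncl (isSubobject_component π γ)) Θ _

/-- `F ⊗_B G` is cyclic over `B` and surjects onto `Φ(F) ⊗ Φ(G)`, where `B` acts by `ε`; so that
tensor product has dimension at most one. It is nonzero, and dimensions multiply. -/
theorem finrank_phi_of_isIso (hH : IsCosemisimple H) {G : RelHopfMod.{u, v, w'} π}
    (h : (tensorObject F G).IsIso (unitObject π)) : Module.finrank ℂ (Phi F) = 1 := by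
  obtain ⟨φ, hφ, -⟩ := exists_isGroupLikeFunctional hH (IsGroupLikeElem.one (R := ℂ) (A := H))
  obtain ⟨e, he, -⟩ := h
  let N := BalancedTensor F G
  let u : (unitObject π).carrier := (1 : Base π)
  have hu : u ≠ 0 := fun h => by
    have h1 : (1 : Base π) = 0 := h
    have := congrArg (fun b : Base π => Coalgebra.counit (R := ℂ) b.1) h1
    simp at this
  have hsm : ∀ b : (unitObject π).carrier, (show Base π from b) • u = b :=
    fun b => mul_one (show Base π from b)
  -- The right action also becomes `ε` on `Φ(F)`, because `ε(a₍₁₎ b S(a₍₂₎)) = ε(a) ε(b)`. This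
  -- makes `q` respect the balancing relations.
  have hright : ∀ (b : Base π) (x : F.carrier), (Submodule.Quotient.mk (F.rightAct b x) : Phi F) =
      Coalgebra.counit (R := ℂ) b.1 • Submodule.Quotient.mk x := by
    intro b x
    have hadj : ∀ a, Coalgebra.counit (R := ℂ) (adj a b.1) =
        Coalgebra.counit (R := ℂ) a * Coalgebra.counit (R := ℂ) b.1 := by
      intro a
      have h1 : ∀ z : A ⊗[ℂ] A, Coalgebra.counit (R := ℂ) (TensorProduct.lift (LinearMap.mk₂ ℂ
          (fun x y => LinearMap.mulLeft ℂ x ∘ₗ LinearMap.mulRight ℂ (HopfAlgebra.antipode ℂ y))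
          (by intros; ext; simp [add_mul]) (by intros; ext; simp)
          (by intros; ext; simp [mul_add]) (by intros; ext; simp)) z b.1) =
          Coalgebra.counit (R := ℂ) (TensorProduct.rid ℂ A (Coalgebra.counit.lTensor A z)) *
            Coalgebra.counit (R := ℂ) b.1 := by
        intro z
        induction z with
        | zero => simp
        | add x y hx hy => simp only [map_add, LinearMap.add_apply, add_mul, hx, hy]
        | tmul x y => simp; ring
      refine (h1 _).trans ?_
      rw [Coalgebra.lTensor_counit_comul]
      simp
    have h2 : ∀ z : A ⊗[ℂ] F.carrier, (Submodule.Quotient.mk (adjAct π F.carrier b z) : Phi F) =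
        Coalgebra.counit (R := ℂ) b.1 • Submodule.Quotient.mk
          (TensorProduct.lid ℂ F.carrier (Coalgebra.counit.rTensor F.carrier z)) := by
      intro z
      induction z with
      | zero => simp
      | add x y hx hy => simp only [map_add, Submodule.Quotient.mk_add, smul_add, hx, hy]
      | tmul a x => simp [mk_base_smul, hadj, smul_smul, mul_comm]
    rw [RelHopfMod.rightAct_apply, h2, F.coaction.counit_coact]
  let q : N →ₗ[ℂ] Phi F ⊗[ℂ] Phi G :=
    (balancingRelations F G).liftQ
      (TensorProduct.map (augmentationSubmodule F).mkQ (augmentationSubmodule G).mkQ) (by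
        refine Submodule.span_le.2 ?_
        rintro _ ⟨x, b, y, rfl⟩
        simp [hright, mk_base_smul, TensorProduct.smul_tmul])
  have hq : ∀ z, q (Submodule.Quotient.mk z) = TensorProduct.map (augmentationSubmodule F).mkQ
      (augmentationSubmodule G).mkQ z := fun _ => rfl
  have hqsurj : Function.Surjective q := by
    intro z
    obtain ⟨y, rfl⟩ := TensorProduct.map_surjective (augmentationSubmodule F).mkQ_surjective
      (augmentationSubmodule G).mkQ_surjective z
    exact ⟨_, hq y⟩
  have hqsmul : ∀ (b : Base π) (z : N), q (b • z) = Coalgebra.counit (R := ℂ) b.1 • q z := by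
    intro b z
    obtain ⟨z, rfl⟩ := Submodule.Quotient.mk_surjective _ z
    rw [smul_mk_balancedTensor, hq, hq]
    induction z with
    | zero => simp
    | add x y hx hy => simp only [map_add, smul_add, hx, hy]
    | tmul x y => simp [mk_base_smul, TensorProduct.smul_tmul']
  let τ : N := e.symm u
  have hspan : ∀ z : N, ∃ b : Base π, z = b • τ := by
    intro z
    refine ⟨(show Base π from e z), e.injective ?_⟩
    refine Eq.trans ?_ (he _ τ).symm
    have : e τ = u := e.apply_symm_apply u
    rw [this]
    exact (hsm _).symm
  -- If `q τ = 0` then `Φ(F) ⊗ Φ(G) = 0`, so over a field one factor vanishes, hence `F = 0` or `G =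
  -- 0`. Then `F ⊗_B G = 0`, contradicting `1 ≠ 0` in `B`.
  have hτ : q τ ≠ 0 := by
    intro h0
    have hall : ∀ z, q z = 0 := fun z => by
      obtain ⟨b, rfl⟩ := hspan z
      rw [hqsmul, h0, smul_zero]
    have hsub : Subsingleton (Phi F ⊗[ℂ] Phi G) :=
      ⟨fun x y => by
        obtain ⟨x, rfl⟩ := hqsurj x
        obtain ⟨y, rfl⟩ := hqsurj y
        rw [hall, hall]⟩
    refine hu ?_
    have hτ0 : τ = 0 := by
      obtain ⟨z, hz⟩ := Submodule.Quotient.mk_surjective _ τ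
      rw [← hz]
      have hz0 : z = 0 := by
        rcases subsingleton_or_nontrivial (Phi F) with h | h
        · have h' := eq_zero_of_augmentationSubmodule_eq_top F hH
            (Submodule.Quotient.subsingleton_iff.1 h)
          have : Subsingleton F.carrier := ⟨fun x y => (h' x).trans (h' y).symm⟩
          exact Subsingleton.elim _ _
        · have h' := eq_zero_of_augmentationSubmodule_eq_top G hH
            (Submodule.Quotient.subsingleton_iff.1
              ((Module.FaithfullyFlat.subsingleton_tensorProduct_iff_right ℂ (Phi F)).1 hsub))
          have : Subsingleton G.carrier := ⟨fun x y => (h' x).trans (h' y).symm⟩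
          exact Subsingleton.elim _ _
      rw [hz0]; rfl
    have : e τ = u := e.apply_symm_apply u
    rw [← this, hτ0]
    exact map_zero e
  have h1 : Module.finrank ℂ (Phi F ⊗[ℂ] Phi G) = 1 := by
    refine finrank_eq_one (q τ) hτ fun z => ?_
    obtain ⟨y, rfl⟩ := hqsurj z
    obtain ⟨b, rfl⟩ := hspan y
    exact ⟨_, (hqsmul b τ).symm⟩
  rw [Module.finrank_tensorProduct] at h1
  exact Nat.eq_one_of_mul_eq_one_right h1

theorem exists_isIso_componentObject (hH : IsCosemisimple H)
    (hF : IsRelativeLineModule F) : ∃ γ : GroupLike ℂ H, F.IsIso (componentObject π γ) := by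
  obtain ⟨G, hG, -⟩ := hF
  obtain ⟨e⟩ := Module.nonempty_linearEquiv_of_finrank_eq_one (finrank_phi_of_isIso hH hG)
  let e' : Phi F ≃ₗ[ℂ] ℂ := e.symm
  let v : Phi F := e 1
  have hv : ∀ x, x = e' x • v := fun x => by
    apply e'.injective; simp [v, e']
  -- On the line `Φ(F) = ℂ v` the coaction must be `v ↦ g ⊗ v`; the comodule axioms, after
  -- cancelling `v`, say exactly that `g` is grouplike.
  let g : H := TensorProduct.rid ℂ H (e'.toLinearMap.lTensor H (phiCoact F v))
  have hg : ∀ x, phiCoact F x = e' x • g ⊗ₜ v := by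
    have hrec : ∀ z : H ⊗[ℂ] Phi F,
        z = (TensorProduct.rid ℂ H (e'.toLinearMap.lTensor H z)) ⊗ₜ v := by
      intro z
      induction z with
      | zero => simp
      | add x y hx hy => rw [map_add, map_add, add_tmul, ← hx, ← hy]
      | tmul h x =>
        simp only [LinearMap.lTensor_tmul, TensorProduct.rid_tmul, TensorProduct.smul_tmul]
        congr 1
        exact hv x
    intro x
    rw [hv x, map_smul, hrec (phiCoact F v)]
    simp [v, e', g, smul_tmul']
  have he'v : e' v = 1 := e.symm_apply_apply 1
  have hgv : phiCoact F v = g ⊗ₜ v := by rw [hg, he'v, one_smul]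
  have hinj : Function.Injective fun z : H ⊗[ℂ] H => z ⊗ₜ[ℂ] v := by
    intro x y hxy
    have := congrArg (fun t => TensorProduct.rid ℂ _ (e'.toLinearMap.lTensor (H ⊗[ℂ] H) t)) hxy
    simpa [he'v] using this
  have hgl : IsGroupLikeElem ℂ g := by
    constructor
    · have h := (phiCoaction F).counit_coact v
      change TensorProduct.lid ℂ _ (Coalgebra.counit.rTensor _ (phiCoact F v)) = v at h
      rw [hgv] at h
      have := congrArg e' h
      simpa [he'v] using this
    · have h := (phiCoaction F).coassoc v
      change TensorProduct.assoc ℂ H H _ (Coalgebra.comul.rTensor _ (phiCoact F v)) =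
        (phiCoact F).lTensor H (phiCoact F v) at h
      rw [hgv, LinearMap.rTensor_tmul, LinearMap.lTensor_tmul, hgv,
        ← LinearEquiv.eq_symm_apply, TensorProduct.assoc_symm_tmul] at h
      exact hinj h
  let f : F.carrier →ₗ[ℂ] ℂ := e'.toLinearMap ∘ₗ (augmentationSubmodule F).mkQ
  refine ⟨⟨g, hgl⟩, isIso_componentObject_of_functional (f := f) hH _ ?_ ?_ fun m => ?_⟩
  · rw [LinearMap.ker_comp, LinearEquiv.ker, Submodule.comap_bot, Submodule.ker_mkQ]
  · intro h0
    obtain ⟨m, hm⟩ := (augmentationSubmodule F).mkQ_surjective v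
    have : f m = 1 := by rw [← he'v, ← hm]; rfl
    rw [h0] at this
    simp at this
  -- `π` of the matrix coefficient at `m` is the matrix coefficient of the `H`-coaction at `[m]`,
  -- which is `f(m) g`.
  · have e1 : ∀ z : A ⊗[ℂ] F.carrier, π (TensorProduct.rid ℂ A (f.lTensor A z)) =
        TensorProduct.rid ℂ H (e'.toLinearMap.lTensor H
          (TensorProduct.map (π : A →ₐ[ℂ] H).toLinearMap (augmentationSubmodule F).mkQ z)) := by
      intro z
      induction z with
      | zero => simp
      | add x y hx hy => simp only [map_add, hx, hy]
      | tmul a m => simp [f]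
    refine (e1 _).trans ?_
    rw [← phiCoact_mk, hg]
    simp [he'v, f]

end LineFunctional

end GroupAlgebraPair

end

theorem mainTheorem6 {A : Type u} [Ring A] [HopfAlgebra ℂ A]
    {H : Type v} [Ring H] [HopfAlgebra ℂ H]
    (hSA : Function.Bijective (HopfAlgebra.antipode ℂ (A := A)))
    (hSH : Function.Bijective (HopfAlgebra.antipode ℂ (A := H)))
    (hH : GroupAlgebraPair.IsCosemisimple H)
    (hcentral : ∀ γ : GroupLike ℂ H, γ.val ∈ Set.center H)
    (π : A →ₐc[ℂ] H) (hπ : Function.Surjective π) :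
    -- the components give a grading of `P` by the group of grouplike elements, and it is strong
    ((iSupIndep (GroupAlgebraPair.component π) ∧
        (⨆ γ, GroupAlgebraPair.component π γ) =
          Subalgebra.toSubmodule (GroupAlgebraPair.Total π)) ∧
      ∀ γ γ' : GroupLike ℂ H,
        GroupAlgebraPair.component π γ * GroupAlgebraPair.component π γ' =
          GroupAlgebraPair.component π (γ * γ')) ∧
    -- `B` is the identity component, and `π` identifies `A / B⁺ A` with `H`
    (GroupAlgebraPair.component π 1 = Subalgebra.toSubmodule (GroupAlgebraPair.Base π) ∧
      ∀ a : A, a ∈ GroupAlgebraPair.augmentationIdeal π ↔ π a = 0) ∧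
    -- each component is a relative line module, and `Φ(E_γ) = π(E_γ) = ℂ γ`
    (∀ γ : GroupLike ℂ H,
      GroupAlgebraPair.IsRelativeLineModule (GroupAlgebraPair.componentObject π γ) ∧
      (GroupAlgebraPair.component π γ).map (π : A →ₐ[ℂ] H).toLinearMap = ℂ ∙ γ.val ∧
      ∃ e : GroupAlgebraPair.Phi (GroupAlgebraPair.componentObject π γ) ≃ₗ[ℂ]
          Submodule.span ℂ {γ.val},
        (∀ x : GroupAlgebraPair.component π γ,
          (e (Submodule.Quotient.mk x) : H) = π x.1) ∧
        ∀ y, Coalgebra.comul (R := ℂ) (e y : H) =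
          ((Submodule.span ℂ {γ.val}).subtype ∘ₗ e.toLinearMap).lTensor H
            ((GroupAlgebraPair.phiCoaction (GroupAlgebraPair.componentObject π γ)).coact y)) ∧
    -- every relative line module over `B` is isomorphic to some component
    (∀ E : GroupAlgebraPair.RelHopfMod.{u, v, w} π, GroupAlgebraPair.IsRelativeLineModule E →
      ∃ γ : GroupLike ℂ H, E.IsIso (GroupAlgebraPair.componentObject π γ)) ∧
    -- the components form the unique decomposition of `P` into simple sub-objects
    (GroupAlgebraPair.IsSimpleDecomposition π (Set.range (GroupAlgebraPair.component π)) ∧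
      ∀ 𝒮 : Set (Submodule ℂ A), GroupAlgebraPair.IsSimpleDecomposition π 𝒮 →
        𝒮 = Set.range (GroupAlgebraPair.component π)) := by
  exact ⟨⟨⟨GroupAlgebraPair.iSupIndep_component hH, GroupAlgebraPair.iSup_component hH hcentral⟩,
      GroupAlgebraPair.component_mul_component hH hπ⟩,
    ⟨GroupAlgebraPair.component_one π, GroupAlgebraPair.mem_augmentationIdeal_iff hH hπ⟩,
    fun γ => ⟨GroupAlgebraPair.isRelativeLineModule_component hH hπ γ,
      GroupAlgebraPair.map_component hH hπ γ, GroupAlgebraPair.exists_phi_component_equiv hH hπ γ⟩,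
    fun _ hE => GroupAlgebraPair.exists_isIso_componentObject hH hE,
    GroupAlgebraPair.isSimpleDecomposition_range_component hH hcentral hπ,
    fun _ h𝒮 => h𝒮.eq_range_component hH hcentral hπ⟩
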